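/- Let $\mathfrak g$ be a finite-dimensional real nilpotent Lie algebra, with group law $X\bullet Y=\log[\exp(X)\exp(Y)]$ given by the (finite) Baker–Campbell–Hausdorff formula, so that $(\mathfrak g,\bullet)$ is the connected simply connected nilpotent Lie group with Lie algebra $\mathfrak g$. Let $dX$ be a Haar measure on $\mathfrak g$, let $d\xi$ be the Haar measure on the dual $\mathfrak g^\sharp$ normalized so that $\mathfrak u\mapsto\int_{\mathfrak g^\sharp}e^{i\langle X|\xi\rangle}\mathfrak u(\xi)\,d\xi$ inverts the Fourier transformation $u\mapsto\int_{\mathfrak g}e^{-i\langle X|\xi\rangle}u(X)\,dX$, and let $\Xi=\mathfrak g\times\mathfrak g^\sharp$ with the measure $dX\,d\xi$. Scalar products are linear in the first variable. For a symbol $f$ on $\Xi$ let $\mathsf{Op}(f)$ be the pseudo-differential operator $$[\mathsf{Op}(f)u](X)=\int_{\mathfrak g^\sharp}\int_{\mathfrak g}e^{i\langle X\bullet(-Y)|\xi\rangle}f(X,\xi)u(Y)\,dY\,d\xi$$ (for Schwartz functions $u$, extended to $L^2(\mathfrak g)$ when it is bounded). Let $f\# g$ be the symbol of $\mathsf{Op}(f)\mathsf{Op}(g)$,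 let $f^\#$ be the symbol of $\mathsf{Op}(f)^*$, and for $(Z,\zeta)\in\Xi$ put $\varepsilon_{(Z,\zeta)}(X,\xi)=e^{i\langle X|\zeta\rangle}e^{-i\langle Z|\xi\rangle}$. For $h,f\in L^2(\Xi)$ and $\mathcal Y,\mathcal Z\in\Xi$ the symbol coorbit transform is $$[\mathfrak E_h(f)](\mathcal Y,\mathcal Z)=\big\langle\varepsilon_{\mathcal Y}\# f\#\varepsilon_{\mathcal Z}^\#,\,h\big\rangle_{L^2(\Xi)},$$ where $\varepsilon_{\mathcal Y}\# f\#\varepsilon_{\mathcal Z}^\#\in L^2(\Xi)$. Then for all $h,f\in L^2(\Xi)$ the function $\mathfrak E_h(f)$ belongs to $L^2(\Xi\times\Xi)$ and $$\|\mathfrak E_h(f)\|_{L^2(\Xi\times\Xi)}=\|h\|_{L^2(\Xi)}\,\|f\|_{L^2(\Xi)}.$$ Moreover $\mathfrak E_h$ is an isometry up to the factor $\|h\|$: for all $h,f,g\in L^2(\Xi)$, $\|\mathfrak E_h(f)-\mathfrak E_h(g)\|_{L^2(\Xi\times\Xi)}=\|h\|_{L^2(\Xi)}\,\|f-g\|_{L^2(\Xi)}$.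 -/

import Mathlib

open MeasureTheory Module
open scoped Nat ComplexConjugate

noncomputable section

namespace NilpotentWeyl

/-! ### The group `(𝔤, •)` of a nilpotent Lie algebra -/

section Group

variable {𝔤 : Type*} [LieRing 𝔤]

/-- The right-nested bracket `[x₁, [x₂, … [xₖ₋₁, xₖ] … ]]` of a word. -/
def nestedBracket : List 𝔤 → 𝔤
  | [] => 0
  | [x] => x
  | x :: y :: l => ⁅x, nestedBracket (y :: l)⁆

/-- The word `X^r₁ Y^s₁ X^r₂ Y^s₂ ⋯ X^rₙ Y^sₙ`, where `p i = (rᵢ, sᵢ)`. -/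
def dynkinWord {n : ℕ} (p : Fin n → ℕ × ℕ) (X Y : 𝔤) : List 𝔤 :=
  (List.ofFn p).flatMap fun q => List.replicate q.1 X ++ List.replicate q.2 Y

/-- The exponents `((r₁, s₁), …, (rₙ, sₙ))` with all `rᵢ + sᵢ > 0` and
`∑ᵢ (rᵢ + sᵢ) = m`. -/
def dynkinIndex (n m : ℕ) : Finset (Fin n → ℕ × ℕ) :=
  (Fintype.piFinset fun _ : Fin n => Finset.range (m + 1) ×ˢ Finset.range (m + 1)).filter
    fun p => (∀ i, 0 < (p i).1 + (p i).2) ∧ ∑ i, ((p i).1 + (p i).2) = m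

variable [LieAlgebra ℝ 𝔤]

/-- The homogeneous part of degree `m` of the Baker–Campbell–Hausdorff series
`log (exp X exp Y)`, in Dynkin's form. -/
def bchTerm (m : ℕ) (X Y : 𝔤) : 𝔤 :=
  ∑ n ∈ Finset.Icc 1 m, ∑ p ∈ dynkinIndex n m,
    ((-1 : ℝ) ^ (n + 1) / ((n : ℝ) * (m : ℝ) * ∏ i, (((p i).1 ! : ℝ) * ((p i).2 ! : ℝ)))) •
      nestedBracket (dynkinWord p X Y)

/-- The group law `X • Y = log (exp X exp Y)` on a nilpotent Lie algebra: the
Baker–Campbell–Hausdorff series, all of whose terms of degree greater than the nilpotency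
length vanish. -/
def bch (X Y : 𝔤) : 𝔤 :=
  ∑ m ∈ Finset.Icc 1 (LieModule.nilpotencyLength 𝔤 𝔤), bchTerm m X Y

end Group

/-! ### Phase space and its measure -/

section Phase

variable (𝔤 : Type*) [LieRing 𝔤] [LieAlgebra ℝ 𝔤]

/-- The smallest σ-algebra on the dual for which all evaluations are measurable; on a
finite-dimensional space it is the Borel σ-algebra. -/
instance dualMeasurableSpace : MeasurableSpace (Dual ℝ 𝔤) :=
  MeasurableSpace.comap (fun (ξ : Dual ℝ 𝔤) (X : 𝔤) => ξ X) MeasurableSpace.pi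

/-- Phase space `Ξ = 𝔤 × 𝔤♯`. -/
abbrev Phase : Type _ := 𝔤 × Dual ℝ 𝔤

variable {𝔤} [FiniteDimensional ℝ 𝔤] [MeasurableSpace 𝔤]

/-- The Haar measure `dξ` on `𝔤♯` for which `∫ e^{i⟨X|ξ⟩} 𝔲(ξ) dξ` is the inverse of the Fourier
transformation `∫ e^{-i⟨X|ξ⟩} u(X) dX`, where `dX = μ`. In the coordinates of a basis of `𝔤` one has
`dX = c dx`, where `c` is the `μ`-volume of the unit cube, and in those of the dual basis
`dξ = (2π)⁻ⁿ c⁻¹ dx`. -/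
def dualHaar (μ : Measure 𝔤) : Measure (Dual ℝ 𝔤) :=
  (ENNReal.ofReal ((2 * Real.pi) ^ finrank ℝ 𝔤) *
      μ ((finBasis ℝ 𝔤).equivFun ⁻¹' Set.Icc 0 1))⁻¹ •
    (volume : Measure (Fin (finrank ℝ 𝔤) → ℝ)).map (finBasis ℝ 𝔤).dualBasis.equivFun.symm

/-- The measure `dX dξ` on phase space. -/
def phaseMeasure (μ : Measure 𝔤) : Measure (Phase 𝔤) :=
  μ.prod (dualHaar μ)

/-- The exponential functions `ε_{(Z,ζ)}(X,ξ) = e^{i⟨X|ζ⟩} e^{-i⟨Z|ξ⟩}` on phase space. -/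
def eps (W : Phase 𝔤) : Phase 𝔤 → ℂ := fun P =>
  Complex.exp (Complex.I * (W.2 P.1 : ℝ)) * Complex.exp (-(Complex.I * (P.2 W.1 : ℝ)))

/-- The Schwartz functions on `𝔤`, in linear coordinates. -/
def IsSchwartz (u : 𝔤 → ℂ) : Prop :=
  ∃ v : SchwartzMap (EuclideanSpace ℝ (Fin (finrank ℝ 𝔤))) ℂ,
    ∀ X, u X = v (WithLp.toLp 2 ((finBasis ℝ 𝔤).equivFun X))

end Phase

/-! ### The quantization and the symbol operations -/

section Quantization

variable {𝔤 : Type*} [LieRing 𝔤] [LieAlgebra ℝ 𝔤] [FiniteDimensional ℝ 𝔤] [MeasurableSpace 𝔤]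
  (μ : Measure 𝔤)

/-- `∫_𝔤 e^{i⟨X • (-Y)|ξ⟩} F(X,ξ) u(Y) dY`. -/
def opInner (F : Phase 𝔤 → ℂ) (u : 𝔤 → ℂ) (X : 𝔤) (ξ : Dual ℝ 𝔤) : ℂ :=
  ∫ Y, Complex.exp (Complex.I * (ξ (bch X (-Y)) : ℝ)) * F (X, ξ) * u Y ∂μ

/-- The bounded operator `A` on `L²(𝔤)` is the pseudo-differential operator with symbol `F`:
on Schwartz functions, `(A u)(X) = ∫_{𝔤♯} ∫_𝔤 e^{i⟨X • (-Y)|ξ⟩} F(X,ξ) u(Y) dY dξ` for almost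
every `X`. -/
def Quantizes (F : Phase 𝔤 → ℂ) (A : Lp ℂ 2 μ →L[ℂ] Lp ℂ 2 μ) : Prop :=
  AEStronglyMeasurable F (phaseMeasure μ) ∧
    ∀ (u : 𝔤 → ℂ) (U : Lp ℂ 2 μ), IsSchwartz u → U =ᵐ[μ] u →
      ∀ᵐ X ∂μ, Integrable (opInner μ F u X) (dualHaar μ) ∧
        A U X = ∫ ξ, opInner μ F u X ξ ∂(dualHaar μ)

open Classical in
/-- `Op(F)`, for a symbol `F` of a bounded operator on `L²(𝔤)` (and `0` for other `F`). -/
def Op (F : Phase 𝔤 → ℂ) : Lp ℂ 2 μ →L[ℂ] Lp ℂ 2 μ :=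
  if h : ∃ A, Quantizes μ F A then h.choose else 0

open Classical in
/-- The product `F # G`, the symbol of `Op(F) Op(G)`, when it belongs to `L²(Ξ)`. This covers the
case where `F` and `G` are symbols of bounded operators and one of them is in `L²(Ξ)`, because
`L²(Ξ)` is the ideal of the symbols of Hilbert–Schmidt operators. -/
def moyal (F G : Phase 𝔤 → ℂ) : Lp ℂ 2 (phaseMeasure μ) :=
  if h : ∃ K : Lp ℂ 2 (phaseMeasure μ), Quantizes μ K (Op μ F ∘L Op μ G) then h.choose else 0

open Classical in
/-- The involution `F^#`: the symbol of the adjoint operator `Op(F)*`, if it is a function. -/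
def adj (F : Phase 𝔤 → ℂ) : Phase 𝔤 → ℂ :=
  if h : ∃ G : Phase 𝔤 → ℂ, Quantizes μ G (ContinuousLinearMap.adjoint (Op μ F)) then h.choose
  else 0

/-- The phase-space shift `θ_{Y,Z}(f) = ε_Y # f # ε_Z^#` of a symbol `f` in `L²(Ξ)`. -/
def theta (Y Z : Phase 𝔤) (f : Lp ℂ 2 (phaseMeasure μ)) : Lp ℂ 2 (phaseMeasure μ) :=
  moyal μ (moyal μ (eps Y) f) (adj μ (eps Z))

/-- The symbol coorbit transform `[𝔈_h(f)](Y,Z) = ⟨θ_{Y,Z}(f), h⟩`. (Mathlib's inner product is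
linear in the second variable.) -/
def symbolCoorbit (h f : Lp ℂ 2 (phaseMeasure μ)) : Phase 𝔤 × Phase 𝔤 → ℂ := fun P =>
  inner ℂ h (theta μ P.1 P.2 f)

end Quantization

end NilpotentWeyl

end

/-! Under quantization `L²(Ξ)` is unitarily the space of Hilbert–Schmidt operators, that is of
kernels in `L²(𝔤 × 𝔤)`. The substitution `W = X • (-Y)` preserves the measure and turns the
oscillatory integral into an ordinary Fourier transform in `ξ`. The kernel of `Op(F)` is therefore a
partial Fourier transform of `F` composed with `(X, Y) ↦ (X, X • (-Y))` (`exists_kernel_equiv`).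

The symbol `ε_{(Z,ζ)}` quantizes to the unitary operator `u ↦ e^{i⟨X|ζ⟩} u(n X Z)`, where `Y = n X
Z` solves `X • (-Y) = Z`. So `θ_{(Y,η),(Z,ζ)}` acts on a kernel `l` by translating both variables
and multiplying by the characters `e^{i⟨X₁|η⟩}` and `e^{-i⟨X₂|ζ⟩}`. With `k`, `l` the kernels of
`h`, `f`, the coorbit transform at fixed `(Y, Z)` is a Fourier transform in `(η, ζ)` of the function
`conj k(X₁, X₂) · l(n X₁ Y, n X₂ Z)` (`exists_symbolCoorbit_eq`). Plancherel removes `(η, ζ)`.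
Tonelli and the invariance of the measure in `(Y, Z)` then give `‖k‖² ‖l‖²`
(`lintegral_kernelCoorbit_sq`). The statement about differences follows by linearity in `f`.

Associativity of the Baker–Campbell–Hausdorff product plays no role. It is enough that `X • Y = X +
Y + q(X, Y)`, where `q` moves one step down the lower central series. Such triangular equations are
solved by finitely many iterations, and the solution maps have Jacobian `±1` and temperate growth
(`exists_isDivision`).

The operations on symbols are defined by choice with a default value, so each use requires existence
and uniqueness of the chosen object: density of Schwartz functions for `Op`, injectivity of
`kernelOp` for `moyal`. -/

noncomputable section

namespace NilpotentWeyl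

open Filter
open scoped ENNReal NNReal

/-! ### Square integrals and weighted composition operators on `L²` -/

section SquareIntegrable

variable {α β : Type*} [MeasurableSpace α] [MeasurableSpace β] {μ : Measure α} {ν : Measure β}

lemma eLpNorm_two_sq {E : Type*} [NormedAddCommGroup E] (f : α → E) :
    eLpNorm f 2 μ ^ 2 = ∫⁻ x, ‖f x‖ₑ ^ 2 ∂μ := by
  have := eLpNorm_nnreal_pow_eq_lintegral (μ := μ) (f := f) (p := 2) (by norm_num)
  simpa using this

lemma memLp_two_iff_lintegral {E : Type*} [NormedAddCommGroup E] {f : α → E}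
    (hf : AEStronglyMeasurable f μ) : MemLp f 2 μ ↔ ∫⁻ x, ‖f x‖ₑ ^ 2 ∂μ < ∞ := by
  rw [← eLpNorm_two_sq]
  simp [MemLp, hf]

lemma enorm_sq_eq_lintegral {E : Type*} [NormedAddCommGroup E] (f : Lp E 2 μ) :
    ‖f‖ₑ ^ 2 = ∫⁻ x, ‖f x‖ₑ ^ 2 ∂μ := by
  rw [← eLpNorm_two_sq, Lp.enorm_def]

lemma integrable_mul_of_memLp_two {f g : α → ℂ} (hf : MemLp f 2 μ) (hg : MemLp g 2 μ) :
    Integrable (fun x => f x * g x) μ :=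
  memLp_one_iff_integrable.1 (hg.mul' hf)

lemma norm_eq_of_enorm_sq_eq {E F : Type*} [NormedAddCommGroup E] [NormedAddCommGroup F] {x : E}
    {y : F} (h : ‖x‖ₑ ^ 2 = ‖y‖ₑ ^ 2) : ‖x‖ = ‖y‖ := by
  have h' : ‖x‖ₑ = ‖y‖ₑ := (ENNReal.pow_right_strictMono two_ne_zero).injective h
  simpa using congrArg ENNReal.toReal h'

/-- Cauchy–Schwarz in extended form, so that it applies to every fiber of a kernel before the fiber
is known to be square-integrable. -/
lemma enorm_integral_mul_sq_le {f g : α → ℂ} (hf : AEStronglyMeasurable f μ)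
    (hg : AEStronglyMeasurable g μ) :
    ‖∫ x, f x * g x ∂μ‖ₑ ^ 2 ≤ (∫⁻ x, ‖f x‖ₑ ^ 2 ∂μ) * ∫⁻ x, ‖g x‖ₑ ^ 2 ∂μ := by
  have h1 : ‖∫ x, f x * g x ∂μ‖ₑ ≤ ∫⁻ x, ‖f x‖ₑ * ‖g x‖ₑ ∂μ := by
    refine (enorm_integral_le_lintegral_enorm _).trans (le_of_eq ?_)
    simp [enorm_mul]
  have h2 := ENNReal.lintegral_mul_le_Lp_mul_Lq μ (Real.HolderConjugate.two_two)
    hf.enorm hg.enorm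
  have h3 : ∀ a : ℝ≥0∞, (a ^ (1 / 2 : ℝ)) ^ 2 = a := fun a => by
    rw [← ENNReal.rpow_natCast, ← ENNReal.rpow_mul]; norm_num
  calc _ ≤ (∫⁻ x, ‖f x‖ₑ * ‖g x‖ₑ ∂μ) ^ 2 := by gcongr
    _ ≤ _ := by
      refine (pow_le_pow_left' h2 2).trans (le_of_eq ?_)
      rw [mul_pow, h3, h3]
      simp

lemma inner_eq_integral (f g : Lp ℂ 2 μ) : inner ℂ f g = ∫ x, conj (f x) * g x ∂μ := by
  rw [L2.inner_def]
  simp [RCLike.inner_apply, mul_comm]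

lemma inner_star_star (f g : Lp ℂ 2 μ) : inner ℂ (star f) (star g) = inner ℂ g f := by
  rw [inner_eq_integral, inner_eq_integral]
  refine integral_congr_ae ?_
  filter_upwards [Lp.coeFn_star f, Lp.coeFn_star g] with x h1 h2
  simp [h1, h2, mul_comm]

/-- Weighted composition `f ↦ w · (f ∘ T)` is unitary between `L²` spaces if `|w| = r` is constant
and `T` scales the measures accordingly. -/
lemma exists_weightedComp (T : α ≃ᵐ β) {w : α → ℂ} (hw : Measurable w) {r : ℝ≥0} (hr : r ≠ 0)
    (hwr : ∀ x, ‖w x‖₊ = r) (hT : μ.map T = ((r ^ 2)⁻¹ : ℝ≥0) • ν) :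
    ∃ U : Lp ℂ 2 ν ≃ₗᵢ[ℂ] Lp ℂ 2 μ, ∀ f, U f =ᵐ[μ] fun x => w x * f (T x) := by
  have hac : μ.map T ≪ ν := by rw [hT]; exact Measure.smul_absolutelyContinuous
  have hq : Measure.QuasiMeasurePreserving T μ ν := ⟨T.measurable, hac⟩
  have hν : ν = ((r ^ 2) : ℝ≥0) • μ.map T := by
    rw [hT, smul_smul, mul_inv_cancel₀ (by positivity), one_smul]
  have key : ∀ f : β → ℂ, ∫⁻ y, ‖f y‖ₑ ^ 2 ∂ν = ∫⁻ x, ‖w x * f (T x)‖ₑ ^ 2 ∂μ := by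
    intro f
    conv_lhs => rw [hν]
    rw [lintegral_smul_measure, lintegral_map_equiv, ENNReal.smul_def, smul_eq_mul,
      ← lintegral_const_mul' _ _ (by simp)]
    refine lintegral_congr fun x => ?_
    rw [enorm_mul, mul_pow, enorm_eq_nnnorm (w x), hwr]
    simp
  have hmeas : ∀ f : Lp ℂ 2 ν, AEStronglyMeasurable (fun x => w x * f (T x)) μ := fun f =>
    hw.aestronglyMeasurable.mul
      ((Lp.stronglyMeasurable f).comp_measurable T.measurable).aestronglyMeasurable
  have hmem : ∀ f : Lp ℂ 2 ν, MemLp (fun x => w x * f (T x)) 2 μ := fun f => by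
    rw [memLp_two_iff_lintegral (hmeas f), ← key, ← memLp_two_iff_lintegral]
    · exact Lp.memLp f
    · exact (Lp.memLp f).1
  let L : Lp ℂ 2 ν →ₗᵢ[ℂ] Lp ℂ 2 μ :=
    { toFun := fun f => (hmem f).toLp _
      map_add' := fun f g => by
        ext1
        filter_upwards [(hmem (f + g)).coeFn_toLp, (hmem f).coeFn_toLp, (hmem g).coeFn_toLp,
          Lp.coeFn_add ((hmem f).toLp _) ((hmem g).toLp _), hq.ae (Lp.coeFn_add f g)]
          with x h1 h2 h3 h4 h5
        rw [h1, h4, Pi.add_apply, h2, h3, h5, Pi.add_apply, mul_add]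
      map_smul' := fun c f => by
        ext1
        filter_upwards [(hmem (c • f)).coeFn_toLp, (hmem f).coeFn_toLp,
          Lp.coeFn_smul c ((hmem f).toLp _), hq.ae (Lp.coeFn_smul c f)]
          with x h1 h2 h4 h5
        rw [h1, RingHom.id_apply, h4, Pi.smul_apply, h2, h5, Pi.smul_apply, smul_eq_mul,
          smul_eq_mul, mul_left_comm]
      norm_map' := fun f => by
        have : ‖(hmem f).toLp _‖ₑ ^ 2 = ‖f‖ₑ ^ 2 := by
          rw [enorm_sq_eq_lintegral, enorm_sq_eq_lintegral, key]
          refine lintegral_congr_ae ?_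
          filter_upwards [(hmem f).coeFn_toLp] with x h1
          rw [h1]
        exact norm_eq_of_enorm_sq_eq this }
  have hL : ∀ f, L f =ᵐ[μ] fun x => w x * f (T x) := fun f => (hmem f).coeFn_toLp
  have hw0 : ∀ x, w x ≠ 0 := fun x => by
    rw [← nnnorm_ne_zero_iff, hwr]; exact hr
  have hsurj : Function.Surjective L := by
    intro g
    let f : β → ℂ := fun y => (w (T.symm y))⁻¹ * g (T.symm y)
    have hfm : AEStronglyMeasurable f ν :=
      ((hw.comp T.symm.measurable).inv.aestronglyMeasurable).mul
        ((Lp.stronglyMeasurable g).comp_measurable T.symm.measurable).aestronglyMeasurable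
    have hf : MemLp f 2 ν := by
      rw [memLp_two_iff_lintegral hfm, key]
      simp only [f, T.symm_apply_apply, mul_inv_cancel_left₀ (hw0 _)]
      rw [← memLp_two_iff_lintegral (Lp.memLp g).1]
      exact Lp.memLp g
    refine ⟨hf.toLp f, ?_⟩
    ext1
    filter_upwards [hL (hf.toLp f), hq.ae hf.coeFn_toLp] with x h1 h2
    rw [h1, h2]
    simp only [f, T.symm_apply_apply, mul_inv_cancel_left₀ (hw0 _)]
  exact ⟨LinearIsometryEquiv.ofSurjective L hsurj, hL⟩

end SquareIntegrable

/-! ### Unitary operators from equal Gram matrices -/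

section Unitary

variable {H₁ H₂ : Type*} [NormedAddCommGroup H₁] [InnerProductSpace ℂ H₁] [CompleteSpace H₁]
  [NormedAddCommGroup H₂] [InnerProductSpace ℂ H₂] [CompleteSpace H₂]

lemma denseRange_linearCombination {ι : Type*} {a : ι → H₁}
    (ha : ∀ x, (∀ i, inner ℂ (a i) x = 0) → x = 0) :
    DenseRange (Finsupp.linearCombination ℂ a) := by
  have h := (Submodule.topologicalClosure_eq_top_iff
    (K := LinearMap.range (Finsupp.linearCombination ℂ a))).2 (by
      rw [Submodule.eq_bot_iff]
      intro x hx
      refine ha x fun i => ?_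
      rw [Submodule.mem_orthogonal] at hx
      exact hx _ ⟨Finsupp.single i 1, by simp⟩)
  have h2 := (Submodule.dense_iff_topologicalClosure_eq_top).2 h
  rwa [LinearMap.coe_range] at h2

omit [CompleteSpace H₁] in
lemma inner_linearCombination_self {ι : Type*} (a : ι → H₁) (c : ι →₀ ℂ) :
    inner ℂ (Finsupp.linearCombination ℂ a c) (Finsupp.linearCombination ℂ a c) =
      c.sum fun i x => c.sum fun j y => conj x * y * inner ℂ (a i) (a j) := by
  simp only [Finsupp.linearCombination_apply, Finsupp.sum, sum_inner]
  refine Finset.sum_congr rfl fun i _ => ?_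
  rw [inner_sum]
  refine Finset.sum_congr rfl fun j _ => ?_
  rw [inner_smul_left, inner_smul_right, mul_assoc]

/-- Two total families with the same Gram matrix are related by a unitary operator. -/
lemma exists_unitary_of_inner_eq {ι : Type*} {a : ι → H₁} {b : ι → H₂}
    (ha : ∀ x, (∀ i, inner ℂ (a i) x = 0) → x = 0) (hb : ∀ x, (∀ i, inner ℂ (b i) x = 0) → x = 0)
    (hab : ∀ i j, inner ℂ (a i) (a j) = inner ℂ (b i) (b j)) :
    ∃ U : H₁ ≃ₗᵢ[ℂ] H₂, ∀ i, U (a i) = b i := by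
  -- The norm of a finite combination depends only on the Gram matrix. Equality of these norms makes
  -- the map on combinations well defined and isometric, and totality makes both ranges dense.
  have hn : ∀ c : ι →₀ ℂ, ‖Finsupp.linearCombination ℂ b (LinearEquiv.refl ℂ _ c)‖ =
      ‖Finsupp.linearCombination ℂ a c‖ := fun c => by
    have : inner ℂ (Finsupp.linearCombination ℂ b c) (Finsupp.linearCombination ℂ b c) =
        inner ℂ (Finsupp.linearCombination ℂ a c) (Finsupp.linearCombination ℂ a c) := by
      rw [inner_linearCombination_self, inner_linearCombination_self]
      simp only [hab]
    rw [inner_self_eq_norm_sq_to_K, inner_self_eq_norm_sq_to_K] at this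
    have h2 : ‖Finsupp.linearCombination ℂ b c‖ ^ 2 = ‖Finsupp.linearCombination ℂ a c‖ ^ 2 := by
      exact_mod_cast this
    exact (sq_eq_sq₀ (norm_nonneg _) (norm_nonneg _)).1 h2
  refine ⟨(LinearEquiv.refl ℂ (ι →₀ ℂ)).extendOfIsometry (Finsupp.linearCombination ℂ a)
    (Finsupp.linearCombination ℂ b) (denseRange_linearCombination ha)
    (denseRange_linearCombination hb) hn, fun i => ?_⟩
  have := LinearEquiv.extendOfIsometry_eq (LinearEquiv.refl ℂ (ι →₀ ℂ))
    (Finsupp.linearCombination ℂ a)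
    (Finsupp.linearCombination ℂ b) (denseRange_linearCombination ha)
    (denseRange_linearCombination hb) hn (Finsupp.single i 1)
  simpa using this

end Unitary

/-! ### Hilbert–Schmidt operators and their kernels -/

section Kernel

variable {α β γ : Type*} [MeasurableSpace α] [MeasurableSpace β] [MeasurableSpace γ]
  {μ : Measure α} {ν : Measure β} {ρ : Measure γ} [SFinite μ] [SFinite ν] [SFinite ρ]

omit [SFinite μ] in
lemma memLp_tens (p : Lp ℂ 2 μ) (q : Lp ℂ 2 ν) :
    MemLp (fun z : α × β => p z.1 * q z.2) 2 (μ.prod ν) := by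
  have hm : AEStronglyMeasurable (fun z : α × β => p z.1 * q z.2) (μ.prod ν) :=
    (((Lp.stronglyMeasurable p).comp_measurable measurable_fst).mul
      ((Lp.stronglyMeasurable q).comp_measurable measurable_snd)).aestronglyMeasurable
  rw [memLp_two_iff_lintegral hm]
  simp only [enorm_mul, mul_pow]
  rw [lintegral_prod_mul (f := fun x => ‖p x‖ₑ ^ 2) (g := fun y => ‖q y‖ₑ ^ 2)
    ((Lp.stronglyMeasurable p).enorm.pow_const 2).aemeasurable
    ((Lp.stronglyMeasurable q).enorm.pow_const 2).aemeasurable]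
  exact ENNReal.mul_lt_top ((memLp_two_iff_lintegral (Lp.memLp p).1).1 (Lp.memLp p))
    ((memLp_two_iff_lintegral (Lp.memLp q).1).1 (Lp.memLp q))

/-- The tensor product `p(x) q(y)` in `L²` of a product space. -/
def tens (p : Lp ℂ 2 μ) (q : Lp ℂ 2 ν) : Lp ℂ 2 (μ.prod ν) := (memLp_tens p q).toLp _

lemma coeFn_tens (p : Lp ℂ 2 μ) (q : Lp ℂ 2 ν) :
    tens p q =ᵐ[μ.prod ν] fun z : α × β => p z.1 * q z.2 := (memLp_tens p q).coeFn_toLp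

omit [SFinite μ] in
lemma lintegral_fiber_sq (K : Lp ℂ 2 (μ.prod ν)) :
    ∫⁻ x, ∫⁻ y, ‖K (x, y)‖ₑ ^ 2 ∂ν ∂μ = ‖K‖ₑ ^ 2 := by
  rw [enorm_sq_eq_lintegral, lintegral_prod _
    ((Lp.stronglyMeasurable K).enorm.pow_const 2).aemeasurable]

omit [SFinite μ] in
lemma ae_memLp_fiber (K : Lp ℂ 2 (μ.prod ν)) : ∀ᵐ x ∂μ, MemLp (fun y => K (x, y)) 2 ν := by
  have h : ∫⁻ x, ∫⁻ y, ‖K (x, y)‖ₑ ^ 2 ∂ν ∂μ ≠ ∞ := by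
    rw [lintegral_fiber_sq]; simp
  have hm : Measurable fun x => ∫⁻ y, ‖K (x, y)‖ₑ ^ 2 ∂ν :=
    Measurable.lintegral_prod_right' (f := fun z => ‖K z‖ₑ ^ 2)
      ((Lp.stronglyMeasurable K).enorm.pow_const 2)
  filter_upwards [ae_lt_top hm h] with x hx
  rw [memLp_two_iff_lintegral]
  · exact hx
  · exact ((Lp.stronglyMeasurable K).comp_measurable measurable_prodMk_left).aestronglyMeasurable

omit [SFinite μ] in
-- Cauchy–Schwarz on each fiber. This gives both that `kernelOp` takes values in `L²` and that its
-- operator norm is at most `‖K‖`.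
lemma lintegral_kernel_sq_le (K : Lp ℂ 2 (μ.prod ν)) (v : Lp ℂ 2 ν) :
    ∫⁻ x, ‖∫ y, K (x, y) * v y ∂ν‖ₑ ^ 2 ∂μ ≤ ‖K‖ₑ ^ 2 * ‖v‖ₑ ^ 2 := by
  calc _ ≤ ∫⁻ x, (∫⁻ y, ‖K (x, y)‖ₑ ^ 2 ∂ν) * ‖v‖ₑ ^ 2 ∂μ := by
        refine lintegral_mono fun x => ?_
        rw [enorm_sq_eq_lintegral v]
        exact enorm_integral_mul_sq_le
          ((Lp.stronglyMeasurable K).comp_measurable measurable_prodMk_left).aestronglyMeasurable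
          (Lp.memLp v).1
    _ = _ := by rw [lintegral_mul_const' _ _ (by simp), lintegral_fiber_sq]

lemma memLp_kernel (K : Lp ℂ 2 (μ.prod ν)) (v : Lp ℂ 2 ν) :
    MemLp (fun x => ∫ y, K (x, y) * v y ∂ν) 2 μ := by
  have hm : StronglyMeasurable fun x => ∫ y, K (x, y) * v y ∂ν :=
    StronglyMeasurable.integral_prod_right' (f := fun z => K z * v z.2)
      ((Lp.stronglyMeasurable K).mul ((Lp.stronglyMeasurable v).comp_measurable measurable_snd))
  rw [memLp_two_iff_lintegral hm.aestronglyMeasurable]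
  exact (lintegral_kernel_sq_le K v).trans_lt (by finiteness)

/-- The Hilbert–Schmidt operator with integral kernel `K`. -/
def kernelOp (K : Lp ℂ 2 (μ.prod ν)) : Lp ℂ 2 ν →L[ℂ] Lp ℂ 2 μ :=
  LinearMap.mkContinuous
    { toFun := fun v => (memLp_kernel K v).toLp _
      map_add' := fun v w => by
        ext1
        filter_upwards [(memLp_kernel K (v + w)).coeFn_toLp, (memLp_kernel K v).coeFn_toLp,
          (memLp_kernel K w).coeFn_toLp, ae_memLp_fiber K,
          Lp.coeFn_add ((memLp_kernel K v).toLp _) ((memLp_kernel K w).toLp _)]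
          with x h1 h2 h3 h4 h5
        rw [h1, h5, Pi.add_apply, h2, h3,
          ← integral_add (integrable_mul_of_memLp_two h4 (Lp.memLp v))
            (integrable_mul_of_memLp_two h4 (Lp.memLp w))]
        refine integral_congr_ae ?_
        filter_upwards [Lp.coeFn_add v w] with y hy
        rw [hy, Pi.add_apply, mul_add]
      map_smul' := fun c v => by
        ext1
        filter_upwards [(memLp_kernel K (c • v)).coeFn_toLp, (memLp_kernel K v).coeFn_toLp,
          Lp.coeFn_smul c ((memLp_kernel K v).toLp _)] with x h1 h2 h5
        rw [h1, RingHom.id_apply, h5, Pi.smul_apply, h2, smul_eq_mul, ← integral_const_mul]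
        refine integral_congr_ae ?_
        filter_upwards [Lp.coeFn_smul c v] with y hy
        rw [hy, Pi.smul_apply, smul_eq_mul, mul_left_comm] } ‖K‖ fun v => by
      have h : ‖(memLp_kernel K v).toLp _‖ₑ ^ 2 ≤ (‖K‖ₑ * ‖v‖ₑ) ^ 2 := by
        rw [mul_pow, enorm_sq_eq_lintegral]
        refine le_trans (le_of_eq ?_) (lintegral_kernel_sq_le K v)
        refine lintegral_congr_ae ?_
        filter_upwards [(memLp_kernel K v).coeFn_toLp] with x h1
        rw [h1]
      have h' : ‖(memLp_kernel K v).toLp _‖ₑ ≤ ‖K‖ₑ * ‖v‖ₑ :=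
        (ENNReal.pow_right_strictMono two_ne_zero).le_iff_le.1 h
      have h'' := ENNReal.toReal_mono (by finiteness) h'
      rw [ENNReal.toReal_mul, toReal_enorm, toReal_enorm, toReal_enorm] at h''
      exact h''

lemma coeFn_kernelOp (K : Lp ℂ 2 (μ.prod ν)) (v : Lp ℂ 2 ν) :
    kernelOp K v =ᵐ[μ] fun x => ∫ y, K (x, y) * v y ∂ν := (memLp_kernel K v).coeFn_toLp

/-- Fubini, legitimate because the elementary tensor and `K` are both in `L²`. It reduces identities
between kernel operators to inner products with elementary tensors. -/
lemma inner_kernelOp (K : Lp ℂ 2 (μ.prod ν)) (v : Lp ℂ 2 ν) (p : Lp ℂ 2 μ) :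
    inner ℂ p (kernelOp K v) = inner ℂ (tens p (star v)) K := by
  have h1 : inner ℂ (tens p (star v)) K =
      ∫ z, conj (p z.1) * (K z * v z.2) ∂μ.prod ν := by
    rw [inner_eq_integral]
    refine integral_congr_ae ?_
    filter_upwards [coeFn_tens p (star v),
      Measure.quasiMeasurePreserving_snd.ae (Lp.coeFn_star v)] with z hz h2
    rw [hz, h2]
    simp only [Pi.star_apply, map_mul, RCLike.star_def, RCLike.conj_conj]
    ring
  have hint : Integrable (fun z : α × β => conj (p z.1) * (K z * v z.2)) (μ.prod ν) := by
    have := integrable_mul_of_memLp_two (μ := μ.prod ν) (memLp_tens (star p) v) (Lp.memLp K)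
    refine this.congr ?_
    filter_upwards [Measure.quasiMeasurePreserving_fst.ae (Lp.coeFn_star p)] with z h2
    rw [h2]
    simp only [Pi.star_apply, RCLike.star_def]
    ring
  rw [h1, integral_prod _ hint, inner_eq_integral]
  refine integral_congr_ae ?_
  filter_upwards [coeFn_kernelOp K v] with x hx
  rw [hx, integral_const_mul]

lemma inner_tens_tens (p p' : Lp ℂ 2 μ) (q q' : Lp ℂ 2 ν) :
    inner ℂ (tens p q) (tens p' q') = inner ℂ p p' * inner ℂ q q' := by
  rw [inner_eq_integral, inner_eq_integral, inner_eq_integral, ← integral_prod_mul]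
  refine integral_congr_ae ?_
  filter_upwards [coeFn_tens p q, coeFn_tens p' q'] with z h1 h2
  rw [h1, h2, map_mul]
  ring

/-- If a countable dense family is annihilated by almost every fiber, so is all of `L²`. -/
lemma ae_forall_integral_eq [SecondCountableTopology (Lp ℂ 2 ρ)]
    (F : Lp ℂ 2 (μ.prod ν)) (K : Lp ℂ 2 (μ.prod ρ)) (Φ : Lp ℂ 2 ρ ≃ₗᵢ[ℂ] Lp ℂ 2 ν)
    (h : ∀ v, kernelOp F (Φ v) = kernelOp K v) :
    ∀ᵐ x ∂μ, ∀ v : Lp ℂ 2 ρ, ∫ y, F (x, y) * Φ v y ∂ν = ∫ y, K (x, y) * v y ∂ρ := by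
  -- The exceptional null set depends on `v`. A dense sequence leaves only countably many of them,
  -- and on square-integrable fibers both sides are continuous in `v`.
  have hc : ∀ᵐ x ∂μ, ∀ n, ∫ y, F (x, y) * Φ (TopologicalSpace.denseSeq (Lp ℂ 2 ρ) n) y ∂ν =
      ∫ y, K (x, y) * TopologicalSpace.denseSeq (Lp ℂ 2 ρ) n y ∂ρ := by
    rw [ae_all_iff]
    intro n
    have := h (TopologicalSpace.denseSeq (Lp ℂ 2 ρ) n)
    filter_upwards [coeFn_kernelOp F (Φ (TopologicalSpace.denseSeq (Lp ℂ 2 ρ) n)),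
      coeFn_kernelOp K (TopologicalSpace.denseSeq (Lp ℂ 2 ρ) n)] with x h1 h2
    rw [← h1, ← h2, this]
  filter_upwards [hc, ae_memLp_fiber F, ae_memLp_fiber K] with x hx hF hK
  have hF' : ∀ v : Lp ℂ 2 ν, ∫ y, F (x, y) * v y ∂ν = inner ℂ (star (hF.toLp _)) v := fun v => by
    rw [inner_eq_integral]
    refine integral_congr_ae ?_
    filter_upwards [Lp.coeFn_star (hF.toLp _), hF.coeFn_toLp] with y h1 h2
    simp [h1, h2]
  have hK' : ∀ v : Lp ℂ 2 ρ, ∫ y, K (x, y) * v y ∂ρ = inner ℂ (star (hK.toLp _)) v := fun v => by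
    rw [inner_eq_integral]
    refine integral_congr_ae ?_
    filter_upwards [Lp.coeFn_star (hK.toLp _), hK.coeFn_toLp] with y h1 h2
    simp [h1, h2]
  have hcont : (fun v : Lp ℂ 2 ρ => ∫ y, F (x, y) * Φ v y ∂ν) =
      fun v => ∫ y, K (x, y) * v y ∂ρ := by
    refine (TopologicalSpace.denseRange_denseSeq (Lp ℂ 2 ρ)).equalizer ?_ ?_ (funext hx)
    · simp only [hF']
      exact Continuous.inner continuous_const Φ.continuous
    · simp only [hK']
      exact Continuous.inner continuous_const continuous_id
  exact fun v => congrFun hcont v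

lemma kernelOp_injective [SecondCountableTopology (Lp ℂ 2 ν)] {K : Lp ℂ 2 (μ.prod ν)}
    (h : kernelOp K = 0) : K = 0 := by
  have h0 : kernelOp (0 : Lp ℂ 2 (μ.prod ν)) = 0 := by
    ext1 v
    refine ext_inner_left ℂ fun p => ?_
    rw [inner_kernelOp]
    simp
  have hfib := ae_forall_integral_eq K (0 : Lp ℂ 2 (μ.prod ν)) (LinearIsometryEquiv.refl ℂ _)
    (fun v => by rw [h0, h]; rfl)
  have hz : ∀ᵐ x ∂μ, ∀ᵐ y ∂ν, (0 : Lp ℂ 2 (μ.prod ν)) (x, y) = 0 :=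
    Measure.ae_ae_of_ae_prod (Lp.coeFn_zero ℂ 2 (μ.prod ν))
  have hK0 : ∫⁻ x, ∫⁻ y, ‖K (x, y)‖ₑ ^ 2 ∂ν ∂μ = 0 := by
    rw [lintegral_eq_zero_iff' (Measurable.lintegral_prod_right' (f := fun z => ‖K z‖ₑ ^ 2)
      ((Lp.stronglyMeasurable K).enorm.pow_const 2)).aemeasurable]
    filter_upwards [hfib, ae_memLp_fiber K, hz] with x hx hKx hzx
    -- The fiber is tested against its own conjugate. This vector depends on `x`, hence the need for
    -- a null set common to all vectors.
    have h1 := hx (star (hKx.toLp _))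
    have h2 : ∫ y, (0 : Lp ℂ 2 (μ.prod ν)) (x, y) * (star (hKx.toLp _) : Lp ℂ 2 ν) y ∂ν = 0 := by
      refine integral_eq_zero_of_ae ?_
      filter_upwards [hzx] with y hy
      rw [hy, zero_mul, Pi.zero_apply]
    have h3 : inner ℂ (hKx.toLp _) (hKx.toLp _) = (0 : ℂ) := by
      rw [← h2, ← h1, inner_eq_integral]
      refine integral_congr_ae ?_
      filter_upwards [Lp.coeFn_star (hKx.toLp _), hKx.coeFn_toLp] with y h1 h2
      simp [h1, h2, mul_comm]
    have h4 : hKx.toLp _ = 0 := inner_self_eq_zero.1 h3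
    have h5 := enorm_sq_eq_lintegral (hKx.toLp _)
    rw [h4] at h5
    simp only [enorm_zero] at h5
    have h6 : ∫⁻ y, ‖K (x, y)‖ₑ ^ 2 ∂ν = ∫⁻ y, ‖(hKx.toLp _ : Lp ℂ 2 ν) y‖ₑ ^ 2 ∂ν := by
      refine lintegral_congr_ae ?_
      filter_upwards [hKx.coeFn_toLp] with y h2
      rw [h2]
    rw [h6, h4, ← h5]
    simp
  rw [lintegral_fiber_sq] at hK0
  simpa using hK0

lemma eq_zero_of_inner_tens [SecondCountableTopology (Lp ℂ 2 ν)] (K : Lp ℂ 2 (μ.prod ν))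
    (h : ∀ p q, inner ℂ (tens p (star q)) K = 0) : K = 0 := by
  refine kernelOp_injective ?_
  ext1 v
  refine ext_inner_left ℂ fun p => ?_
  rw [inner_kernelOp, h]
  simp

lemma kernelOp_sub (K L : Lp ℂ 2 (μ.prod ν)) : kernelOp (K - L) = kernelOp K - kernelOp L := by
  ext1 v
  refine ext_inner_left ℂ fun p => ?_
  simp [inner_kernelOp, inner_sub_right]

/-- The unitary operator `K ↦ F` between spaces of kernels with `A_F ∘ Φ = A_K`. -/
lemma exists_partialUnitary [SecondCountableTopology (Lp ℂ 2 ν)]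
    [SecondCountableTopology (Lp ℂ 2 ρ)] (Φ : Lp ℂ 2 ρ ≃ₗᵢ[ℂ] Lp ℂ 2 ν) :
    ∃ W : Lp ℂ 2 (μ.prod ρ) ≃ₗᵢ[ℂ] Lp ℂ 2 (μ.prod ν),
      ∀ K v, kernelOp (W K) (Φ v) = kernelOp K v := by
  -- `W` should send `p ⊗ v̄` to `p ⊗ conj(Φ v)`. The Gram matrices agree because `Φ` is unitary and
  -- conjugation reverses inner products on both sides.
  obtain ⟨W, hW⟩ := exists_unitary_of_inner_eq (ι := Lp ℂ 2 μ × Lp ℂ 2 ρ)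
    (a := fun i => tens i.1 (star i.2)) (b := fun i => tens i.1 (star (Φ i.2)))
    (fun x hx => eq_zero_of_inner_tens x fun p q => hx (p, q))
    (fun x hx => eq_zero_of_inner_tens x fun p q => by simpa using hx (p, Φ.symm q))
    (fun i j => by
      simp only [inner_tens_tens, inner_star_star, LinearIsometryEquiv.inner_map_map])
  refine ⟨W, fun K v => ext_inner_left ℂ fun p => ?_⟩
  rw [inner_kernelOp, inner_kernelOp, ← hW (p, v), LinearIsometryEquiv.inner_map_map]

end Kernel

/-! ### The `L²` Fourier transform as an integral -/

section Fourier

open FourierTransform Real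

variable {E : Type*} [NormedAddCommGroup E] [InnerProductSpace ℝ E] [FiniteDimensional ℝ E]
  [MeasurableSpace E] [BorelSpace E]

lemma continuous_fourierInv {f : E → ℂ} (hf : Integrable f) : Continuous (𝓕⁻ f) := by
  change Continuous (VectorFourier.fourierIntegral 𝐞 volume (-innerₗ E) f)
  refine VectorFourier.fourierIntegral_continuous Real.continuous_fourierChar ?_ hf
  simp only [LinearMap.neg_apply, innerₗ_apply_apply]
  fun_prop

lemma integral_fourierInv_mul {f g : E → ℂ} (hf : Integrable f) (hg : Integrable g) :
    ∫ y, 𝓕⁻ f y * g y = ∫ x, f x * 𝓕⁻ g x := by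
  have h := VectorFourier.integral_fourierIntegral_smul_eq_flip (e := 𝐞) (μ := (volume : Measure E))
    (ν := (volume : Measure E)) (L := -innerₗ E) Real.continuous_fourierChar (by
      simp only [LinearMap.neg_apply, innerₗ_apply_apply]; fun_prop) hf hg
  have hflip : (-innerₗ E).flip = -innerₗ E := by
    ext x y; simp [real_inner_comm]
  rw [hflip] at h
  exact h

/-- The `L²`-Fourier transform is given by the Fourier integral on `L¹ ∩ L²`. -/
lemma coeFn_fourierInv_toLp {f : E → ℂ} (hf : Integrable f) (hf2 : MemLp f 2) :
    (𝓕⁻ (hf2.toLp f) : Lp ℂ 2 (volume : Measure E)) =ᵐ[volume] 𝓕⁻ f := by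
  -- Both sides are compared as distributions: on a test function the `L²` transform moves over by
  -- its compatibility with tempered distributions, the integral transform by Fubini.
  refine ae_eq_of_integral_contDiff_smul_eq ((Lp.memLp _).locallyIntegrable (by norm_num))
    (continuous_fourierInv hf).locallyIntegrable fun g hg hgc => ?_
  have hgC : ContDiff ℝ (⊤ : ℕ∞) fun x => (g x : ℂ) := Complex.ofRealCLM.contDiff.comp hg
  have hgcC : HasCompactSupport fun x => (g x : ℂ) := hgc.comp_left Complex.ofReal_zero
  let g' : SchwartzMap E ℂ := hgcC.toSchwartzMap hgC
  have hg' : ∀ x, g' x = (g x : ℂ) := fun x => rfl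
  have h1 := congrArg (fun T => T g') (Lp.fourierInv_toTemperedDistribution_eq (hf2.toLp f))
  simp only [TemperedDistribution.fourierInv_apply, Lp.toTemperedDistribution_apply,
    smul_eq_mul] at h1
  have h2 := integral_fourierInv_mul hf g'.integrable
  calc ∫ x, g x • (𝓕⁻ (hf2.toLp f) : Lp ℂ 2 (volume : Measure E)) x
      = ∫ x, g' x * (𝓕⁻ (hf2.toLp f) : Lp ℂ 2 (volume : Measure E)) x := by
        simp only [hg', Complex.real_smul]
    _ = ∫ x, (𝓕⁻ g') x * (hf2.toLp f) x := h1.symm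
    _ = ∫ x, f x * 𝓕⁻ (g' : E → ℂ) x := by
        rw [SchwartzMap.fourierInv_coe]
        refine integral_congr_ae ?_
        filter_upwards [hf2.coeFn_toLp] with x hx
        rw [hx, mul_comm]
    _ = ∫ x, g x • 𝓕⁻ f x := by
        rw [← h2]
        simp only [hg', Complex.real_smul, mul_comm]

end Fourier

/-! ### Linear coordinates on the Lie algebra and its dual -/

section Coordinates

variable (𝔤 : Type*) [LieRing 𝔤] [LieAlgebra ℝ 𝔤] [FiniteDimensional ℝ 𝔤]

/-- The Euclidean coordinate space of `𝔤`. -/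
abbrev Coord : Type := EuclideanSpace ℝ (Fin (finrank ℝ 𝔤))

/-- The linear coordinates on `𝔤` given by the chosen basis. -/
def coordLinear : Coord 𝔤 ≃ₗ[ℝ] 𝔤 :=
  (WithLp.linearEquiv 2 ℝ (Fin (finrank ℝ 𝔤) → ℝ)).trans (finBasis ℝ 𝔤).equivFun.symm

variable {𝔤} in
lemma coordLinear_symm_apply (X : 𝔤) :
    (coordLinear 𝔤).symm X = WithLp.toLp 2 ((finBasis ℝ 𝔤).equivFun X) := rfl

lemma coordLinear_apply (x : Coord 𝔤) :
    coordLinear 𝔤 x = ∑ i, x i • finBasis ℝ 𝔤 i := by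
  simp [coordLinear, Basis.equivFun_symm_apply]

omit [FiniteDimensional ℝ 𝔤] in
variable {𝔤} in
lemma measurable_dual_apply (X : 𝔤) : Measurable fun ξ : Dual ℝ 𝔤 => ξ X :=
  (measurable_pi_apply X).comp
    (comap_measurable fun (ξ : Dual ℝ 𝔤) (X : 𝔤) => ξ X)

/-- The coordinates on the dual space, scaled so that the pairing is `2π` times the inner
product. -/
def dualCoord : Coord 𝔤 ≃ᵐ Dual ℝ 𝔤 where
  toFun y := (2 * Real.pi) • (finBasis ℝ 𝔤).dualBasis.equivFun.symm (WithLp.ofLp y)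
  invFun ξ := WithLp.toLp 2 fun i => (2 * Real.pi)⁻¹ * ξ (finBasis ℝ 𝔤 i)
  left_inv y := by
    ext i
    simp [Basis.equivFun_symm_apply, Finsupp.single_apply]
    field_simp
  right_inv ξ := by
    refine (finBasis ℝ 𝔤).ext fun i => ?_
    simp [Basis.equivFun_symm_apply, Finsupp.single_apply]
    field_simp
  measurable_toFun := by
    rw [measurable_comap_iff, measurable_pi_iff]
    intro X
    refine Continuous.measurable ?_
    simp only [Function.comp_def, Basis.equivFun_symm_apply, Equiv.coe_fn_mk, LinearMap.smul_apply,
      LinearMap.sum_apply]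
    fun_prop
  measurable_invFun := by
    refine (WithLp.measurable_toLp 2 _).comp ?_
    rw [measurable_pi_iff]
    intro i
    exact (measurable_dual_apply (finBasis ℝ 𝔤 i)).const_mul _

variable {𝔤} in
lemma dualCoord_apply_coordLinear (x y : Coord 𝔤) :
    dualCoord 𝔤 y (coordLinear 𝔤 x) = 2 * Real.pi * inner ℝ x y := by
  simp [dualCoord, coordLinear_apply, Basis.equivFun_symm_apply, Finsupp.single_apply,
    PiLp.inner_apply, Finset.mul_sum]
  refine Finset.sum_congr rfl fun i _ => by ring

variable [TopologicalSpace 𝔤] [IsTopologicalAddGroup 𝔤] [ContinuousSMul ℝ 𝔤] [T2Space 𝔤]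

/-- The coordinates on `𝔤` as a homeomorphism. -/
def coordL : Coord 𝔤 ≃L[ℝ] 𝔤 := (coordLinear 𝔤).toContinuousLinearEquiv

lemma secondCountableTopology_of_coord : SecondCountableTopology 𝔤 :=
  (coordL 𝔤).symm.toHomeomorph.secondCountableTopology

variable [MeasurableSpace 𝔤] [BorelSpace 𝔤]

/-- The coordinates on `𝔤` as a measurable equivalence. -/
def coordM : Coord 𝔤 ≃ᵐ 𝔤 := (coordL 𝔤).toHomeomorph.toMeasurableEquiv

lemma coordM_apply (x : Coord 𝔤) : coordM 𝔤 x = coordLinear 𝔤 x := rfl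

variable {𝔤} (μ : Measure 𝔤) [μ.IsAddHaarMeasure]

lemma map_coordM_cube : (volume : Measure (Coord 𝔤)).map (coordM 𝔤)
    ((finBasis ℝ 𝔤).equivFun ⁻¹' Set.Icc 0 1) = 1 := by
  rw [(coordM 𝔤).map_apply]
  have h : coordM 𝔤 ⁻¹' ((finBasis ℝ 𝔤).equivFun ⁻¹' Set.Icc 0 1) =
      WithLp.ofLp ⁻¹' (Set.Icc (0 : Fin (finrank ℝ 𝔤) → ℝ) 1) := by
    ext x
    rw [Set.mem_preimage, Set.mem_preimage, Set.mem_preimage]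
    change (finBasis ℝ 𝔤).equivFun ((finBasis ℝ 𝔤).equivFun.symm (WithLp.ofLp x)) ∈
      Set.Icc (0 : Fin (finrank ℝ 𝔤) → ℝ) 1 ↔ _
    rw [LinearEquiv.apply_symm_apply]
  rw [h, (PiLp.volume_preserving_ofLp (Fin (finrank ℝ 𝔤))).measure_preimage
    measurableSet_Icc.nullMeasurableSet, Real.volume_Icc_pi]
  simp

lemma map_coordM_isAddHaar : ((volume : Measure (Coord 𝔤)).map (coordM 𝔤)).IsAddHaarMeasure :=
  (coordL 𝔤).isAddHaarMeasure_map volume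

lemma exists_eq_smul_map_coordM : ∃ c : ℝ≥0, c ≠ 0 ∧
    μ = c • (volume : Measure (Coord 𝔤)).map (coordM 𝔤) := by
  have := map_coordM_isAddHaar (𝔤 := 𝔤)
  have := secondCountableTopology_of_coord 𝔤
  have : LocallyCompactSpace 𝔤 := (coordL 𝔤).symm.toHomeomorph.isClosedEmbedding.locallyCompactSpace
  refine ⟨_, (Measure.addHaarScalarFactor_pos_of_isAddHaarMeasure μ
    ((volume : Measure (Coord 𝔤)).map (coordM 𝔤))).ne', Measure.isAddLeftInvariant_eq_smul μ _⟩

/-- The constant `c` is the `μ`-volume of the unit cube. The factor `(2π)⁻ⁿ` of `dualHaar` is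
absorbed by the scaling in `dualCoord`, so the same `c` enters inversely on the two sides; this
makes the Fourier transformation unitary. -/
lemma map_coordM_eq : ∃ c : ℝ≥0, c ≠ 0 ∧ (volume : Measure (Coord 𝔤)).map (coordM 𝔤) = c⁻¹ • μ ∧
    (volume : Measure (Coord 𝔤)).map (dualCoord 𝔤) = c • dualHaar μ := by
  obtain ⟨c, hc, hμ⟩ := exists_eq_smul_map_coordM μ
  refine ⟨c, hc, by rw [hμ, smul_smul, inv_mul_cancel₀ hc, one_smul], ?_⟩
  have hcube : μ ((finBasis ℝ 𝔤).equivFun ⁻¹' Set.Icc 0 1) = c := by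
    rw [hμ, Measure.smul_apply, map_coordM_cube]
    simp
  have h2pi : (0 : ℝ) < 2 * Real.pi := by positivity
  have hmeas : Measurable ((finBasis ℝ 𝔤).dualBasis.equivFun.symm) := by
    rw [measurable_comap_iff, measurable_pi_iff]
    intro X
    refine Continuous.measurable ?_
    simp only [Function.comp_def, Basis.equivFun_symm_apply, LinearMap.smul_apply,
      LinearMap.sum_apply]
    fun_prop
  have hdual : (volume : Measure (Coord 𝔤)).map (dualCoord 𝔤) =
      ENNReal.ofReal ((2 * Real.pi) ^ finrank ℝ 𝔤)⁻¹ •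
        (volume : Measure (Fin (finrank ℝ 𝔤) → ℝ)).map (finBasis ℝ 𝔤).dualBasis.equivFun.symm := by
    have hcomp : (dualCoord 𝔤 : Coord 𝔤 → Dual ℝ 𝔤) = (finBasis ℝ 𝔤).dualBasis.equivFun.symm ∘
        (fun x => (2 * Real.pi) • x) ∘ WithLp.ofLp := by
      ext1 y
      simp [dualCoord]
    rw [hcomp, ← Measure.map_map hmeas ((measurable_const_smul _).comp (WithLp.measurable_ofLp 2 _)),
      ← Measure.map_map (measurable_const_smul _) (WithLp.measurable_ofLp 2 _),
      (PiLp.volume_preserving_ofLp (Fin (finrank ℝ 𝔤))).map_eq,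
      Measure.map_addHaar_smul _ h2pi.ne', Measure.map_smul, finrank_fintype_fun_eq_card,
      Fintype.card_fin, abs_of_pos (by positivity)]
  rw [hdual, dualHaar, hcube, ENNReal.smul_def, smul_smul]
  congr 1
  rw [ENNReal.mul_inv (by right; simp) (by left; simp), ENNReal.ofReal_inv_of_pos (by positivity),
    mul_left_comm, ENNReal.mul_inv_cancel (by simpa using hc) (by simp), mul_one]

end Coordinates

/-! ### Fourier transformation and Schwartz functions on the Lie algebra -/

section LieFourier

open FourierTransform

variable {𝔤 : Type*} [LieRing 𝔤] [LieAlgebra ℝ 𝔤] [FiniteDimensional ℝ 𝔤]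
  [TopologicalSpace 𝔤] [IsTopologicalAddGroup 𝔤] [ContinuousSMul ℝ 𝔤] [T2Space 𝔤]
  [MeasurableSpace 𝔤] [BorelSpace 𝔤] (μ : Measure 𝔤)

/-- The Fourier integral `∫ e^{i⟨X|ξ⟩} u(X) dX`. -/
def hat (u : 𝔤 → ℂ) (ξ : Dual ℝ 𝔤) : ℂ := ∫ X, Complex.exp (Complex.I * (ξ X : ℝ)) * u X ∂μ

lemma eq_smul_map_of_map_eq {α β : Type*} [MeasurableSpace α] [MeasurableSpace β] {μ : Measure α}
    {ν : Measure β} {T : α ≃ᵐ β} {c : ℝ≥0} (hc : c ≠ 0) (h : μ.map T = c • ν) :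
    ν = c⁻¹ • μ.map T := by
  rw [h, smul_smul, inv_mul_cancel₀ hc, one_smul]

lemma hat_dualCoord {c : ℝ≥0} (hc : c ≠ 0)
    (h : (volume : Measure (Coord 𝔤)).map (coordM 𝔤) = c⁻¹ • μ) (u : 𝔤 → ℂ) (y : Coord 𝔤) :
    hat μ u (dualCoord 𝔤 y) = c * 𝓕⁻ (u ∘ coordM 𝔤) y := by
  rw [hat, eq_smul_map_of_map_eq (inv_ne_zero hc) h, inv_inv, integral_smul_nnreal_measure,
    integral_map_equiv, Real.fourierInv_eq', NNReal.smul_def, Complex.real_smul]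
  congr 1
  refine integral_congr_ae (Eventually.of_forall fun x => ?_)
  simp only [coordM_apply, dualCoord_apply_coordLinear, Function.comp_apply, smul_eq_mul]
  rw [mul_comm Complex.I]

lemma integrable_comp_coordM {c : ℝ≥0} (hc : c ≠ 0)
    (h : (volume : Measure (Coord 𝔤)).map (coordM 𝔤) = c⁻¹ • μ) {u : 𝔤 → ℂ} :
    Integrable (u ∘ coordM 𝔤) volume ↔ Integrable u μ := by
  rw [← integrable_map_equiv, h]
  exact integrable_smul_measure (c := ((c⁻¹ : ℝ≥0) : ℝ≥0∞)) (by simpa using hc)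
    ENNReal.coe_ne_top

lemma memLp_comp_coordM {c : ℝ≥0} (hc : c ≠ 0)
    (h : (volume : Measure (Coord 𝔤)).map (coordM 𝔤) = c⁻¹ • μ) {u : 𝔤 → ℂ} :
    MemLp (u ∘ coordM 𝔤) 2 volume ↔ MemLp u 2 μ := by
  have h1 := (coordM 𝔤).memLp_map_measure_iff (μ := volume) (g := u) (p := 2)
  rw [← h1]
  constructor
  · intro h2
    rw [eq_smul_map_of_map_eq (inv_ne_zero hc) h]
    exact h2.smul_measure (c := (((c⁻¹)⁻¹ : ℝ≥0) : ℝ≥0∞)) ENNReal.coe_ne_top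
  · intro h2
    rw [h]
    exact h2.smul_measure (c := ((c⁻¹ : ℝ≥0) : ℝ≥0∞)) ENNReal.coe_ne_top

lemma ae_of_ae_map {α β : Type*} [MeasurableSpace α] [MeasurableSpace β] {μ : Measure α}
    {ν : Measure β} {T : α ≃ᵐ β} {c : ℝ≥0} (hc : c ≠ 0) (h : μ.map T = c • ν) {p : β → Prop}
    (hp : ∀ᵐ x ∂μ, p (T x)) : ∀ᵐ y ∂ν, p y := by
  rw [eq_smul_map_of_map_eq hc h]
  exact Measure.ae_smul_measure (T.measurableEmbedding.ae_map_iff.2 hp) _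

lemma ae_comp_of_map_eq {α β : Type*} [MeasurableSpace α] [MeasurableSpace β] {μ : Measure α}
    {ν : Measure β} {T : α ≃ᵐ β} {c : ℝ≥0} (h : μ.map T = c • ν) {p : β → Prop}
    (hp : ∀ᵐ y ∂ν, p y) : ∀ᵐ x ∂μ, p (T x) := by
  rw [← T.measurableEmbedding.ae_map_iff, h]
  exact Measure.ae_smul_measure hp _

variable [μ.IsAddHaarMeasure]

/-- The Fourier transformation as a unitary operator `L²(𝔤) → L²(𝔤♯)`. -/
lemma exists_fourierUnitary : ∃ Φ : Lp ℂ 2 μ ≃ₗᵢ[ℂ] Lp ℂ 2 (dualHaar μ),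
    ∀ (u : 𝔤 → ℂ) (_ : Integrable u μ) (hu2 : MemLp u 2 μ),
      Φ (hu2.toLp u) =ᵐ[dualHaar μ] hat μ u := by
  obtain ⟨c, hc, h1, h2⟩ := map_coordM_eq μ
  have hs : NNReal.sqrt c ≠ 0 := by simpa using hc
  -- The weights `√c` for `R` and `1/√c` for `S` compensate the two scalings of measure. The
  -- operator is `S⁻¹ ∘ 𝓕⁻ ∘ R`, with the inverse transform because `hat` has the sign `e^{+i}`.
  obtain ⟨R, hR⟩ := exists_weightedComp (μ := (volume : Measure (Coord 𝔤))) (ν := μ) (coordM 𝔤)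
    (w := fun _ => ((NNReal.sqrt c : ℝ≥0) : ℂ)) measurable_const hs (fun _ => by ext; simp)
    (by rw [NNReal.sq_sqrt]; exact h1)
  obtain ⟨S, hS⟩ := exists_weightedComp (μ := (volume : Measure (Coord 𝔤))) (ν := dualHaar μ)
    (dualCoord 𝔤) (w := fun _ => (((NNReal.sqrt c)⁻¹ : ℝ≥0) : ℂ)) measurable_const
    (inv_ne_zero hs) (fun _ => by ext; simp) (by rw [inv_pow, NNReal.sq_sqrt, inv_inv]; exact h2)
  refine ⟨(R.trans (Lp.fourierTransformₗᵢ (Coord 𝔤) ℂ).symm).trans S.symm, fun u hu hu2 => ?_⟩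
  set U := ((R.trans (Lp.fourierTransformₗᵢ (Coord 𝔤) ℂ).symm).trans S.symm) (hu2.toLp u) with hU
  have hSU : S U = 𝓕⁻ (R (hu2.toLp u)) := by
    simp [hU]
    rfl
  have hf : Integrable (u ∘ coordM 𝔤) := (integrable_comp_coordM μ hc h1).2 hu
  have hf2 : MemLp (u ∘ coordM 𝔤) 2 volume := (memLp_comp_coordM μ hc h1).2 hu2
  have hg2 : MemLp (((NNReal.sqrt c : ℝ≥0) : ℂ) • (u ∘ coordM 𝔤)) 2 volume := hf2.const_smul _
  have hRu : R (hu2.toLp u) = hg2.toLp _ := by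
    ext1
    filter_upwards [hR (hu2.toLp u), hg2.coeFn_toLp, ae_comp_of_map_eq h1 hu2.coeFn_toLp]
      with x e1 e2 e3
    rw [e1, e2, e3]
    rfl
  refine ae_of_ae_map hc h2 ?_
  filter_upwards [hS U, coeFn_fourierInv_toLp (hf.smul _) hg2] with y e1 e2
  rw [hSU, hRu, e2] at e1
  have e3 : 𝓕⁻ (((NNReal.sqrt c : ℝ≥0) : ℂ) • (u ∘ coordM 𝔤)) y =
      ((NNReal.sqrt c : ℝ≥0) : ℂ) * 𝓕⁻ (u ∘ coordM 𝔤) y := by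
    rw [Real.fourierInv_eq', Real.fourierInv_eq', ← integral_const_mul]
    simp [mul_left_comm]
  rw [e3] at e1
  rw [hat_dualCoord μ hc h1]
  have hsq : ((NNReal.sqrt c : ℝ≥0) : ℂ) * ((NNReal.sqrt c : ℝ≥0) : ℂ) = ((c : ℝ≥0) : ℂ) := by
    exact_mod_cast congrArg (fun r : ℝ≥0 => (r : ℂ)) (NNReal.mul_self_sqrt c)
  have e4 := congrArg (fun z => ((NNReal.sqrt c : ℝ≥0) : ℂ) * z) e1
  rw [← mul_assoc, hsq, ← mul_assoc] at e4
  rw [e4]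
  have hone : ((NNReal.sqrt c : ℝ≥0) : ℂ) * (((NNReal.sqrt c)⁻¹ : ℝ≥0) : ℂ) = 1 := by
    rw [← Complex.ofReal_mul, ← NNReal.coe_mul, mul_inv_cancel₀ hs]
    simp
  rw [hone, one_mul]

variable {μ}

omit [IsTopologicalAddGroup 𝔤] [ContinuousSMul ℝ 𝔤] [T2Space 𝔤] [BorelSpace 𝔤]
  [TopologicalSpace 𝔤] [MeasurableSpace 𝔤] in
lemma isSchwartz_iff {u : 𝔤 → ℂ} :
    IsSchwartz u ↔ ∃ v : SchwartzMap (Coord 𝔤) ℂ, u ∘ coordLinear 𝔤 = v := by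
  constructor
  · rintro ⟨v, hv⟩
    refine ⟨v, funext fun x => ?_⟩
    rw [Function.comp_apply, hv, ← coordLinear_symm_apply, LinearEquiv.symm_apply_apply]
  · rintro ⟨v, hv⟩
    refine ⟨v, fun X => ?_⟩
    rw [← coordLinear_symm_apply, ← hv, Function.comp_apply, LinearEquiv.apply_symm_apply]

lemma IsSchwartz.integrable {u : 𝔤 → ℂ} (hu : IsSchwartz u) : Integrable u μ := by
  obtain ⟨c, hc, h1, -⟩ := map_coordM_eq μ
  obtain ⟨v, hv⟩ := isSchwartz_iff.1 hu
  rw [← integrable_comp_coordM μ hc h1]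
  change Integrable (u ∘ coordLinear 𝔤) _
  rw [hv]
  exact v.integrable

lemma IsSchwartz.memLp {u : 𝔤 → ℂ} (hu : IsSchwartz u) : MemLp u 2 μ := by
  obtain ⟨c, hc, h1, -⟩ := map_coordM_eq μ
  obtain ⟨v, hv⟩ := isSchwartz_iff.1 hu
  rw [← memLp_comp_coordM μ hc h1]
  change MemLp (u ∘ coordLinear 𝔤) _ _
  rw [hv]
  exact v.memLp 2

lemma IsSchwartz.integrable_hat {u : 𝔤 → ℂ} (hu : IsSchwartz u) :
    Integrable (hat μ u) (dualHaar μ) := by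
  obtain ⟨c, hc, h1, h2⟩ := map_coordM_eq μ
  obtain ⟨v, hv⟩ := isSchwartz_iff.1 hu
  rw [eq_smul_map_of_map_eq hc h2]
  refine Integrable.smul_measure (c := ((c⁻¹ : ℝ≥0) : ℝ≥0∞)) ?_ ENNReal.coe_ne_top
  rw [integrable_map_equiv]
  have : hat μ u ∘ dualCoord 𝔤 = fun y => (c : ℂ) * 𝓕⁻ v y := by
    funext y
    rw [Function.comp_apply, hat_dualCoord μ hc h1]
    change _ * 𝓕⁻ (u ∘ coordLinear 𝔤) y = _
    rw [hv, SchwartzMap.fourierInv_coe]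
  rw [this]
  exact (𝓕⁻ v).integrable.const_mul _

/-- Fourier inversion at every point: the factor `c` of `hat` cancels the `c⁻¹` of the dual measure.
Through it a symbol `e^{-i⟨z|ξ⟩}` acts as evaluation at `z`. -/
lemma IsSchwartz.integral_hat {u : 𝔤 → ℂ} (hu : IsSchwartz u) (Z : 𝔤) :
    ∫ ξ, Complex.exp (-(Complex.I * (ξ Z : ℝ))) * hat μ u ξ ∂(dualHaar μ) = u Z := by
  obtain ⟨c, hc, h1, h2⟩ := map_coordM_eq μ
  obtain ⟨v, hv⟩ := isSchwartz_iff.1 hu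
  obtain ⟨z, rfl⟩ := (coordLinear 𝔤).surjective Z
  have hinv : 𝓕 (𝓕⁻ v) = v := FourierTransform.fourier_fourierInv_eq v
  have h3 : u (coordLinear 𝔤 z) = 𝓕 (𝓕⁻ (v : Coord 𝔤 → ℂ)) z := by
    rw [← SchwartzMap.fourierInv_coe, ← SchwartzMap.fourier_coe, hinv, ← hv]
    rfl
  have hc' : (c : ℂ) ≠ 0 := by exact_mod_cast hc
  rw [h3, Real.fourier_eq', eq_smul_map_of_map_eq hc h2, integral_smul_nnreal_measure,
    integral_map_equiv, NNReal.smul_def, Complex.real_smul, ← integral_const_mul]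
  refine integral_congr_ae (Eventually.of_forall fun y => ?_)
  simp only
  rw [hat_dualCoord μ hc h1, dualCoord_apply_coordLinear]
  change _ * (_ * (_ * 𝓕⁻ (u ∘ coordLinear 𝔤) y)) = _
  rw [hv, smul_eq_mul]
  push_cast
  have : -(Complex.I * (2 * Real.pi * ((inner ℝ z y : ℝ) : ℂ))) =
      -2 * Real.pi * ((inner ℝ y z : ℝ) : ℂ) * Complex.I := by
    rw [real_inner_comm]; ring
  rw [this]
  field_simp

lemma IsSchwartz.ext_clm {F : Type*} [NormedAddCommGroup F] [NormedSpace ℂ F]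
    {A B : Lp ℂ 2 μ →L[ℂ] F}
    (h : ∀ (u : 𝔤 → ℂ) (hu : IsSchwartz u), A (hu.memLp.toLp u) = B (hu.memLp.toLp u)) :
    A = B := by
  obtain ⟨c, hc, h1, -⟩ := map_coordM_eq μ
  have hs : NNReal.sqrt c ≠ 0 := by simpa using hc
  have hs' : ((NNReal.sqrt c : ℝ≥0) : ℂ) ≠ 0 := by exact_mod_cast hs
  obtain ⟨R, hR⟩ := exists_weightedComp (μ := (volume : Measure (Coord 𝔤))) (ν := μ) (coordM 𝔤)
    (w := fun _ => ((NNReal.sqrt c : ℝ≥0) : ℂ)) measurable_const hs (fun _ => by ext; simp)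
    (by rw [NNReal.sq_sqrt]; exact h1)
  suffices hAB : A ∘ R.symm = B ∘ R.symm by
    ext1 f
    have := congrFun hAB (R f)
    simpa using this
  refine (SchwartzMap.denseRange_toLpCLM (p := 2) (μ := (volume : Measure (Coord 𝔤))) (F := ℂ)
    ENNReal.ofNat_ne_top).equalizer (A.continuous.comp R.symm.continuous)
    (B.continuous.comp R.symm.continuous) ?_
  funext v
  have hu : IsSchwartz fun X : 𝔤 => v ((coordLinear 𝔤).symm X) :=
    isSchwartz_iff.2 ⟨v, funext fun x => by simp⟩
  have hv : R.symm (v.toLp 2) = (((NNReal.sqrt c : ℝ≥0) : ℂ)⁻¹) • hu.memLp.toLp _ := by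
    rw [LinearIsometryEquiv.symm_apply_eq, map_smul]
    ext1
    filter_upwards [v.coeFn_toLp 2, Lp.coeFn_smul (((NNReal.sqrt c : ℝ≥0) : ℂ)⁻¹)
      (R (hu.memLp.toLp _)), hR (hu.memLp.toLp _),
      ae_comp_of_map_eq h1 hu.memLp.coeFn_toLp] with x e1 e2 e3 e4
    rw [e1, e2, Pi.smul_apply, e3, e4, smul_eq_mul, inv_mul_cancel_left₀ hs', coordM_apply,
      LinearEquiv.symm_apply_apply]
  simp only [Function.comp_apply, SchwartzMap.toLpCLM_apply, hv, map_smul, h _ hu]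

end LieFourier

/-! ### Maps of temperate growth -/

section Temperate

variable {𝔤 : Type*} [LieRing 𝔤] [LieAlgebra ℝ 𝔤] [FiniteDimensional ℝ 𝔤]

lemma hasTemperateGrowth_prodMk {D E F : Type*} [NormedAddCommGroup D] [NormedSpace ℝ D]
    [NormedAddCommGroup E] [NormedSpace ℝ E] [NormedAddCommGroup F] [NormedSpace ℝ F]
    {f : D → E} {g : D → F} (hf : f.HasTemperateGrowth) (hg : g.HasTemperateGrowth) :
    (fun x => (f x, g x)).HasTemperateGrowth := by
  have h1 := (ContinuousLinearMap.inl ℝ E F).hasTemperateGrowth.comp hf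
  have h2 := (ContinuousLinearMap.inr ℝ E F).hasTemperateGrowth.comp hg
  convert h1.add h2 using 1
  ext x <;> simp

/-- Temperate growth of a map on `𝔤`, in coordinates. -/
def Temperate (q : 𝔤 → 𝔤) : Prop :=
  Function.HasTemperateGrowth fun x : Coord 𝔤 => (coordLinear 𝔤).symm (q (coordLinear 𝔤 x))

/-- Temperate growth of a map of two variables on `𝔤`, in coordinates. -/
def Temperate₂ (q : 𝔤 → 𝔤 → 𝔤) : Prop :=
  Function.HasTemperateGrowth fun p : Coord 𝔤 × Coord 𝔤 =>
    (coordLinear 𝔤).symm (q (coordLinear 𝔤 p.1) (coordLinear 𝔤 p.2))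

namespace Temperate₂

variable {p q r : 𝔤 → 𝔤 → 𝔤}

lemma fst : Temperate₂ fun x _ : 𝔤 => x := by
  simp only [Temperate₂, LinearEquiv.symm_apply_apply]
  exact (ContinuousLinearMap.fst ℝ (Coord 𝔤) (Coord 𝔤)).hasTemperateGrowth

lemma snd : Temperate₂ fun _ y : 𝔤 => y := by
  simp only [Temperate₂, LinearEquiv.symm_apply_apply]
  exact (ContinuousLinearMap.snd ℝ (Coord 𝔤) (Coord 𝔤)).hasTemperateGrowth

lemma zero : Temperate₂ fun _ _ : 𝔤 => 0 := by
  simp only [Temperate₂, map_zero]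
  exact Function.HasTemperateGrowth.zero

lemma add (hp : Temperate₂ p) (hq : Temperate₂ q) : Temperate₂ fun x y => p x y + q x y := by
  simp only [Temperate₂, map_add]
  exact Function.HasTemperateGrowth.add hp hq

lemma smul (c : ℝ) (hp : Temperate₂ p) : Temperate₂ fun x y => c • p x y := by
  simp only [Temperate₂, map_smul]
  exact Function.HasTemperateGrowth.smul (Function.HasTemperateGrowth.const c) hp

lemma sum {ι : Type*} {s : Finset ι} {p : ι → 𝔤 → 𝔤 → 𝔤} (hp : ∀ i ∈ s, Temperate₂ (p i)) :
    Temperate₂ fun x y => ∑ i ∈ s, p i x y := by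
  simp only [Temperate₂, map_sum]
  exact Function.HasTemperateGrowth.sum hp

lemma lie (hp : Temperate₂ p) (hq : Temperate₂ q) : Temperate₂ fun x y => ⁅p x y, q x y⁆ := by
  let B₀ : Coord 𝔤 →ₗ[ℝ] Coord 𝔤 →ₗ[ℝ] Coord 𝔤 := LinearMap.mk₂ ℝ
    (fun x y => (coordLinear 𝔤).symm ⁅coordLinear 𝔤 x, coordLinear 𝔤 y⁆)
    (by simp) (by simp) (by simp) (by simp)
  let B := LinearMap.toContinuousBilinearMap B₀
  have h := B.bilinear_hasTemperateGrowth hp hq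
  have hB : ∀ x y, B x y = (coordLinear 𝔤).symm ⁅coordLinear 𝔤 x, coordLinear 𝔤 y⁆ :=
    fun x y => rfl
  simpa only [hB, LinearEquiv.apply_symm_apply] using! h

lemma comp (hp : Temperate₂ p) (hq : Temperate₂ q) (hr : Temperate₂ r) :
    Temperate₂ fun x y => p (q x y) (r x y) := by
  have h := Function.HasTemperateGrowth.comp hp (hasTemperateGrowth_prodMk hq hr)
  simpa [Temperate₂, Function.comp_def] using h

lemma swap (hp : Temperate₂ p) : Temperate₂ fun x y => p y x := hp.comp snd fst

lemma left (hp : Temperate₂ p) (x : 𝔤) : Temperate (p x) := by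
  have h := Function.HasTemperateGrowth.comp hp (hasTemperateGrowth_prodMk
    (Function.HasTemperateGrowth.const ((coordLinear 𝔤).symm x)) Function.HasTemperateGrowth.id)
  simpa [Temperate, Function.comp_def] using h

variable [TopologicalSpace 𝔤] [IsTopologicalAddGroup 𝔤] [ContinuousSMul ℝ 𝔤] [T2Space 𝔤]

lemma continuous (hp : Temperate₂ p) : Continuous fun z : 𝔤 × 𝔤 => p z.1 z.2 := by
  have h1 : Continuous fun z : 𝔤 × 𝔤 => ((coordL 𝔤).symm z.1, (coordL 𝔤).symm z.2) :=
    ((coordL 𝔤).symm.continuous.comp continuous_fst).prodMk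
      ((coordL 𝔤).symm.continuous.comp continuous_snd)
  have h := (coordL 𝔤).continuous.comp (hp.1.continuous.comp h1)
  refine h.congr fun z => ?_
  change coordLinear 𝔤 ((coordLinear 𝔤).symm (p (coordLinear 𝔤 ((coordLinear 𝔤).symm z.1))
    (coordLinear 𝔤 ((coordLinear 𝔤).symm z.2)))) = _
  simp only [LinearEquiv.apply_symm_apply]

end Temperate₂

/-- Decay of `u ∘ f` requires `f` to grow at least like a power of `‖x‖`. The polynomial bound on
the left inverse `g`, taken at `f x`, says exactly this. -/
lemma IsSchwartz.comp_temperate {u : 𝔤 → ℂ} (hu : IsSchwartz u) {f g : 𝔤 → 𝔤} (hf : Temperate f)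
    (hg : Temperate g) (hgf : ∀ x, g (f x) = x) : IsSchwartz (u ∘ f) := by
  obtain ⟨v, hv⟩ := isSchwartz_iff.1 hu
  obtain ⟨k, C, hC⟩ := hg.2 0
  have hup : ∃ (k : ℕ) (C : ℝ), ∀ x : Coord 𝔤,
      ‖x‖ ≤ C * (1 + ‖(coordLinear 𝔤).symm (f (coordLinear 𝔤 x))‖) ^ k := by
    refine ⟨k, C, fun x => ?_⟩
    have := hC ((coordLinear 𝔤).symm (f (coordLinear 𝔤 x)))
    simpa [hgf] using this
  refine isSchwartz_iff.2 ⟨SchwartzMap.compCLM ℝ hf hup v, funext fun x => ?_⟩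
  have : v ((coordLinear 𝔤).symm (f (coordLinear 𝔤 x))) = u (f (coordLinear 𝔤 x)) := by
    rw [← hv]; simp
  simp only [Function.comp_apply]
  exact this.symm

end Temperate

/-! ### Maps compatible with the lower central series -/

section Lowering

variable {𝔤 : Type*} [LieRing 𝔤] [LieAlgebra ℝ 𝔤]

open LieModule

/-- `q` maps pairs congruent modulo the `j`-th term of the lower central series to elements that
are congruent modulo its `(j + i)`-th term. -/
def Lowering (i : ℕ) (q : 𝔤 → 𝔤 → 𝔤) : Prop :=
  ∀ ⦃j : ℕ⦄ ⦃x x' y y' : 𝔤⦄, x - x' ∈ lowerCentralSeries ℝ 𝔤 𝔤 j →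
    y - y' ∈ lowerCentralSeries ℝ 𝔤 𝔤 j → q x y - q x' y' ∈ lowerCentralSeries ℝ 𝔤 𝔤 (j + i)

lemma lie_mem_lowerCentralSeries_succ {j : ℕ} (x : 𝔤) {y : 𝔤}
    (hy : y ∈ lowerCentralSeries ℝ 𝔤 𝔤 j) : ⁅x, y⁆ ∈ lowerCentralSeries ℝ 𝔤 𝔤 (j + 1) := by
  rw [lowerCentralSeries_succ]
  exact LieSubmodule.lie_mem_lie (LieSubmodule.mem_top x) hy

namespace Lowering

variable {i : ℕ} {p q r : 𝔤 → 𝔤 → 𝔤}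

lemma fst : Lowering 0 fun x _ : 𝔤 => x := fun _ _ _ _ _ h _ => h

lemma snd : Lowering 0 fun _ y : 𝔤 => y := fun _ _ _ _ _ _ h => h

lemma const (c : 𝔤) : Lowering i fun _ _ : 𝔤 => c := fun _ _ _ _ _ _ _ => by simp

lemma add (hp : Lowering i p) (hq : Lowering i q) : Lowering i fun x y => p x y + q x y :=
  fun _ _ _ _ _ h h' => by
    simpa only [add_sub_add_comm] using add_mem (hp h h') (hq h h')

lemma smul (c : ℝ) (hp : Lowering i p) : Lowering i fun x y => c • p x y :=
  fun _ _ _ _ _ h h' => by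
    rw [← smul_sub]
    exact (lowerCentralSeries ℝ 𝔤 𝔤 _).toSubmodule.smul_mem c (hp h h')

lemma sum {ι : Type*} {s : Finset ι} {p : ι → 𝔤 → 𝔤 → 𝔤} (hp : ∀ k ∈ s, Lowering i (p k)) :
    Lowering i fun x y => ∑ k ∈ s, p k x y := fun _ _ _ _ _ h h' => by
  rw [← Finset.sum_sub_distrib]
  exact sum_mem fun k hk => hp k hk h h'

/-- The difference telescopes into two brackets, each with one entry in the `j`-th term, and a
bracket descends by one more. -/
lemma lie (hp : Lowering 0 p) (hq : Lowering 0 q) : Lowering 1 fun x y => ⁅p x y, q x y⁆ :=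
  fun j x x' y y' h h' => by
    have h1 : ⁅p x y, q x y⁆ - ⁅p x' y', q x' y'⁆ =
        ⁅p x y, q x y - q x' y'⁆ - ⁅q x' y', p x y - p x' y'⁆ := by
      rw [lie_sub, lie_sub, ← lie_skew (p x y) (q x' y'), ← lie_skew (p x' y') (q x' y')]
      abel
    rw [h1]
    exact sub_mem (lie_mem_lowerCentralSeries_succ _ (hq h h'))
      (lie_mem_lowerCentralSeries_succ _ (hp h h'))

lemma of_succ (hp : Lowering 1 p) : Lowering 0 p := fun _ _ _ _ _ h h' =>
  antitone_lowerCentralSeries ℝ 𝔤 𝔤 (Nat.le_succ _) (hp h h')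

lemma comp (hp : Lowering i p) (hq : Lowering 0 q) (hr : Lowering 0 r) :
    Lowering i fun x y => p (q x y) (r x y) := fun _ _ _ _ _ h h' => hp (hq h h') (hr h h')

lemma swap (hp : Lowering i p) : Lowering i fun x y => p y x := hp.comp snd fst

end Lowering

end Lowering

/-! ### Triangular form of the Baker–Campbell–Hausdorff product -/

section BCH

variable {𝔤 : Type*} [LieRing 𝔤] [LieAlgebra ℝ 𝔤] [FiniteDimensional ℝ 𝔤]

open LieModule

/-- The outermost bracket alone supplies the descent by one step, so the induction only needs
`Lowering 0` of the tail. -/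
lemma temperate_nestedBracket (l : List (𝔤 → 𝔤 → 𝔤)) (hl : ∀ g ∈ l, Lowering 0 g ∧ Temperate₂ g) :
    (Lowering 0 fun x y => nestedBracket (l.map fun g => g x y)) ∧
      (2 ≤ l.length → Lowering 1 fun x y => nestedBracket (l.map fun g => g x y)) ∧
      Temperate₂ fun x y => nestedBracket (l.map fun g => g x y) := by
  induction l with
  | nil => exact ⟨Lowering.const 0, by simp, Temperate₂.zero⟩
  | cons a l ih =>
    cases l with
    | nil => exact ⟨(hl a (by simp)).1, by simp, (hl a (by simp)).2⟩
    | cons b l =>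
      obtain ⟨h1, -, h3⟩ := ih fun g hg => hl g (List.mem_cons_of_mem _ hg)
      have ha := hl a (by simp)
      have h4 := Lowering.lie ha.1 h1
      exact ⟨h4.of_succ, fun _ => h4, Temperate₂.lie ha.2 h3⟩

/-- The word of coordinate projections whose evaluation is `dynkinWord`. -/
def dynkinLetters {n : ℕ} (p : Fin n → ℕ × ℕ) : List (𝔤 → 𝔤 → 𝔤) :=
  (List.ofFn p).flatMap fun q =>
    List.replicate q.1 (fun x _ => x) ++ List.replicate q.2 (fun _ y => y)

omit [LieAlgebra ℝ 𝔤] [FiniteDimensional ℝ 𝔤] [LieRing 𝔤] in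
lemma dynkinLetters_map {n : ℕ} (p : Fin n → ℕ × ℕ) (x y : 𝔤) :
    (dynkinLetters p).map (fun g => g x y) = dynkinWord p x y := by
  simp [dynkinLetters, dynkinWord, List.map_flatMap]

omit [LieAlgebra ℝ 𝔤] [FiniteDimensional ℝ 𝔤] [LieRing 𝔤] in
lemma length_dynkinLetters {n : ℕ} (p : Fin n → ℕ × ℕ) :
    (dynkinLetters p : List (𝔤 → 𝔤 → 𝔤)).length = ∑ i, ((p i).1 + (p i).2) := by
  simp [dynkinLetters, List.length_flatMap, List.map_ofFn, List.sum_ofFn]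

lemma bchTerm_lowering {m : ℕ} (hm : 2 ≤ m) :
    Lowering 1 (bchTerm (𝔤 := 𝔤) m) ∧ Temperate₂ (bchTerm (𝔤 := 𝔤) m) := by
  have key : ∀ n, ∀ p ∈ dynkinIndex n m,
      Lowering 1 (fun x y : 𝔤 => nestedBracket (dynkinWord p x y)) ∧
        Temperate₂ fun x y : 𝔤 => nestedBracket (dynkinWord p x y) := fun n p hp => by
    have hlen : (dynkinLetters p : List (𝔤 → 𝔤 → 𝔤)).length = m := by
      rw [length_dynkinLetters]
      exact (Finset.mem_filter.1 hp).2.2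
    have h := temperate_nestedBracket (dynkinLetters p : List (𝔤 → 𝔤 → 𝔤)) (fun g hg => by
      simp only [dynkinLetters, List.mem_flatMap, List.mem_append, List.mem_replicate] at hg
      obtain ⟨q, -, ⟨-, rfl⟩ | ⟨-, rfl⟩⟩ := hg
      · exact ⟨Lowering.fst, Temperate₂.fst⟩
      · exact ⟨Lowering.snd, Temperate₂.snd⟩)
    simp only [dynkinLetters_map] at h
    exact ⟨h.2.1 (hlen ▸ hm), h.2.2⟩
  exact ⟨Lowering.sum fun n _ => Lowering.sum fun p hp => ((key n p hp).1).smul _,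
    Temperate₂.sum fun n _ => Temperate₂.sum fun p hp => ((key n p hp).2).smul _⟩

omit [FiniteDimensional ℝ 𝔤] in
lemma bchTerm_one (x y : 𝔤) : bchTerm 1 x y = x + y := by
  have h : dynkinIndex 1 1 = {fun _ => (1, 0), fun _ => (0, 1)} := by decide
  rw [bchTerm, Finset.Icc_self, Finset.sum_singleton, h, Finset.sum_pair (by decide)]
  simp [dynkinWord, nestedBracket]

lemma exists_bch_eq [LieModule.IsNilpotent 𝔤 𝔤] : ∃ q : 𝔤 → 𝔤 → 𝔤, Lowering 1 q ∧ Temperate₂ q ∧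
    ∀ x y, bch x y = x + y + q x y := by
  -- With length zero the series defining `bch` is empty and lacks even the term `x + y`; the
  -- identity then holds because `𝔤` is trivial.
  by_cases h : nilpotencyLength 𝔤 𝔤 = 0
  · have := (nilpotencyLength_eq_zero_iff (L := 𝔤) (M := 𝔤)).1 h
    exact ⟨fun _ _ => 0, Lowering.const 0, Temperate₂.zero, fun _ _ => Subsingleton.elim _ _⟩
  · refine ⟨fun x y => ∑ m ∈ Finset.Icc 2 (nilpotencyLength 𝔤 𝔤), bchTerm m x y,
      Lowering.sum fun m hm => (bchTerm_lowering (Finset.mem_Icc.1 hm).1).1,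
      Temperate₂.sum fun m hm => (bchTerm_lowering (Finset.mem_Icc.1 hm).1).2, fun x y => ?_⟩
    rw [bch, ← Finset.add_sum_Ioc_eq_sum_Icc (Nat.one_le_iff_ne_zero.2 h), bchTerm_one]
    rfl

/-- Triangular equations `y = x + b z + p x y` have triangular solutions. -/
lemma exists_solution [LieModule.IsNilpotent 𝔤 𝔤] {p : 𝔤 → 𝔤 → 𝔤} (hp : Lowering 1 p)
    (hp' : Temperate₂ p) (b : ℝ) : ∃ r : 𝔤 → 𝔤 → 𝔤, Lowering 1 r ∧ Temperate₂ r ∧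
      ∀ x y z, y = x + b • z + p x y ↔ y = x + b • z + r x z := by
  obtain ⟨k, hk⟩ := IsNilpotent.nilpotent ℝ 𝔤 𝔤
  -- Fixed-point iteration. Each step gains one term of the lower central series, so the `k`-th
  -- iterate is exact once that series vanishes at `k`: `hconv` gives uniqueness of the solution,
  -- `hfix` its existence.
  let r : ℕ → 𝔤 → 𝔤 → 𝔤 := fun n => Nat.rec (fun _ _ => 0)
    (fun _ s x z => p x (x + b • z + s x z)) n
  have hr1 : ∀ n x z, r (n + 1) x z = p x (x + b • z + r n x z) := fun _ _ _ => rfl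
  have hL : ∀ n, Lowering 1 (r n) := by
    intro n
    induction n with
    | zero => exact Lowering.const 0
    | succ n ih =>
      exact hp.comp Lowering.fst ((Lowering.fst.add (Lowering.snd.smul b)).add ih.of_succ)
  have hT : ∀ n, Temperate₂ (r n) := by
    intro n
    induction n with
    | zero => exact Temperate₂.zero
    | succ n ih =>
      exact hp'.comp Temperate₂.fst ((Temperate₂.fst.add (Temperate₂.snd.smul b)).add ih)
  have hconv : ∀ x y z, y = x + b • z + p x y →
      ∀ n, y - (x + b • z + r n x z) ∈ lowerCentralSeries ℝ 𝔤 𝔤 n := by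
    intro x y z hy n
    induction n with
    | zero => simp
    | succ n ih =>
      have h := hp (j := n) (x := x) (x' := x) (by simp) ih
      have h2 : y - (x + b • z + r (n + 1) x z) = p x y - p x (x + b • z + r n x z) := by
        rw [hr1]
        nth_rewrite 1 [hy]
        abel
      rw [h2]
      exact h
  have hfix : ∀ x z n, r (n + 1) x z - r n x z ∈ lowerCentralSeries ℝ 𝔤 𝔤 n := by
    intro x z n
    induction n with
    | zero => simp
    | succ n ih =>
      rw [hr1 (n + 1), hr1 n]
      exact hp (by simp) (by simpa using ih)
  refine ⟨r k, hL k, hT k, fun x y z => ⟨fun hy => ?_, fun hy => ?_⟩⟩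
  · have := hconv x y z hy k
    rw [hk, LieSubmodule.mem_bot, sub_eq_zero] at this
    exact this
  · have := hfix x z k
    rw [hk, LieSubmodule.mem_bot, sub_eq_zero, hr1, ← hy] at this
    rw [this]
    exact hy

end BCH

/-! ### Triangular maps preserve Haar measure; division in the group -/

section Triangular

open LieModule Topology

lemma det_one_add_of_isNilpotent {V : Type*} [AddCommGroup V] [Module ℝ V] [FiniteDimensional ℝ V]
    {N : Module.End ℝ V} (hN : IsNilpotent N) : LinearMap.det (1 + N) = 1 := by
  have h := LinearMap.eval_charpoly (-N) (1 : ℝ)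
  rw [_root_.IsNilpotent.charpoly_eq_X_pow_finrank hN.neg] at h
  simpa using h.symm

/-- The difference quotients stay in `W`, which is closed, being a finite-dimensional subspace. -/
lemma hasFDerivAt_apply_mem {E : Type*} [NormedAddCommGroup E] [NormedSpace ℝ E]
    [FiniteDimensional ℝ E] {f : E → E} {L : E →L[ℝ] E} {x v w : E} {W : Submodule ℝ E}
    (hf : HasFDerivAt f L x) (h : ∀ t : ℝ, f (x + t • v) - f x - t • w ∈ W) : L v - w ∈ W := by
  have h1 : HasDerivAt (fun t : ℝ => f (x + t • v) - f x - t • w) (L v - w) 0 := by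
    have h2 := hf.hasLineDerivAt v
    have h3 : HasDerivAt (fun t : ℝ => f (x + t • v)) (L v) 0 := h2
    simpa using! (h3.sub_const (f x)).sub ((hasDerivAt_id (0 : ℝ)).smul_const w)
  rw [hasDerivAt_iff_tendsto_slope] at h1
  refine W.closed_of_finiteDimensional.mem_of_tendsto h1 (Eventually.of_forall fun t => ?_)
  rw [slope_def_module]
  exact W.smul_mem _ (W.sub_mem (h t) (h 0))

variable {𝔤 : Type*} [LieRing 𝔤] [LieAlgebra ℝ 𝔤] [FiniteDimensional ℝ 𝔤]
  [LieModule.IsNilpotent 𝔤 𝔤]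

/-- Here `σ = ±1` and `σ L = 1 + N`, where `N` pushes every term of the lower central series into
the next and is therefore nilpotent. -/
lemma abs_det_eq_one_of_triangular {L : Coord 𝔤 →L[ℝ] Coord 𝔤} {σ : ℝ} (hσ : σ * σ = 1)
    (hL : ∀ j v, coordLinear 𝔤 v ∈ lowerCentralSeries ℝ 𝔤 𝔤 j →
      coordLinear 𝔤 (L v - σ • v) ∈ lowerCentralSeries ℝ 𝔤 𝔤 (j + 1)) : |L.det| = 1 := by
  obtain ⟨k, hk⟩ := IsNilpotent.nilpotent ℝ 𝔤 𝔤
  let N : Module.End ℝ (Coord 𝔤) := σ • (L : Coord 𝔤 →ₗ[ℝ] Coord 𝔤) - 1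
  have hN : ∀ v, N v = σ • (L v - σ • v) := fun v => by
    simp [N, smul_sub, smul_smul, hσ]
  have hpow : ∀ j v, coordLinear 𝔤 ((N ^ j) v) ∈ lowerCentralSeries ℝ 𝔤 𝔤 j := by
    intro j
    induction j with
    | zero => simp
    | succ j ih =>
      intro v
      rw [pow_succ', Module.End.mul_apply, hN, map_smul]
      exact (lowerCentralSeries ℝ 𝔤 𝔤 _).toSubmodule.smul_mem _ (hL j _ (ih v))
  have hnil : IsNilpotent N := by
    refine ⟨k, LinearMap.ext fun v => ?_⟩
    have := hpow k v
    rw [hk, LieSubmodule.mem_bot, LinearEquiv.map_eq_zero_iff] at this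
    simpa using this
  have hdet := det_one_add_of_isNilpotent hnil
  rw [show 1 + N = σ • (L : Coord 𝔤 →ₗ[ℝ] Coord 𝔤) by simp [N], LinearMap.det_smul] at hdet
  have habs : |σ| = 1 := by
    have : |σ| * |σ| = 1 := by rw [← abs_mul, hσ, abs_one]
    nlinarith [abs_nonneg σ]
  have := congrArg abs hdet
  rw [abs_mul, abs_pow, habs, one_pow, one_mul, abs_one] at this
  exact this

variable [TopologicalSpace 𝔤] [IsTopologicalAddGroup 𝔤] [ContinuousSMul ℝ 𝔤] [T2Space 𝔤]
  [MeasurableSpace 𝔤] [BorelSpace 𝔤] (μ : Measure 𝔤) [μ.IsAddHaarMeasure]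

/-- Passing to the derivative in the congruences gives Jacobian `±1` everywhere, and the change of
variables formula applies to the bijection `f`. -/
lemma measurePreserving_of_triangular {f g : 𝔤 → 𝔤} (hf : Temperate f) (hgf : ∀ x, g (f x) = x)
    (hfg : ∀ y, f (g y) = y) {σ : ℝ} (hσ : σ * σ = 1)
    (htri : ∀ j x v, v ∈ lowerCentralSeries ℝ 𝔤 𝔤 j →
      f (x + v) - f x - σ • v ∈ lowerCentralSeries ℝ 𝔤 𝔤 (j + 1)) : MeasurePreserving f μ μ := by
  obtain ⟨c, hc, h1, -⟩ := map_coordM_eq μ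
  set F : Coord 𝔤 → Coord 𝔤 := fun x => (coordLinear 𝔤).symm (f (coordLinear 𝔤 x)) with hF
  have hdiff : Differentiable ℝ F := hf.1.differentiable (by simp)
  have hdet : ∀ x, |(fderiv ℝ F x).det| = 1 := fun x => by
    refine abs_det_eq_one_of_triangular hσ fun j v hv => ?_
    have := hasFDerivAt_apply_mem (hdiff x).hasFDerivAt (v := v) (w := σ • v)
      (W := (lowerCentralSeries ℝ 𝔤 𝔤 (j + 1)).toSubmodule.comap (coordLinear 𝔤).toLinearMap)
      (fun t => by
        rw [Submodule.mem_comap]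
        have := htri j (coordLinear 𝔤 x) (t • coordLinear 𝔤 v)
          ((lowerCentralSeries ℝ 𝔤 𝔤 j).toSubmodule.smul_mem t hv)
        simpa [hF, smul_comm t σ] using this)
    exact this
  have hinj : Function.Injective F := fun x y hxy => by
    have h2 := (coordLinear 𝔤).symm.injective hxy
    have h3 := congrArg g h2
    rw [hgf, hgf] at h3
    exact (coordLinear 𝔤).injective h3
  have hsurj : Function.Surjective F := fun y =>
    ⟨(coordLinear 𝔤).symm (g (coordLinear 𝔤 y)), by simp [hF, hfg]⟩
  have hmap : (volume : Measure (Coord 𝔤)).map F = volume := by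
    have := map_withDensity_abs_det_fderiv_eq_addHaar (volume : Measure (Coord 𝔤))
      (s := Set.univ) (f := F) (f' := fderiv ℝ F) nullMeasurableSet_univ
      (fun x _ => (hdiff x).hasFDerivAt.hasFDerivWithinAt) hinj.injOn
    simpa [hdet, hsurj.range_eq, Measure.restrict_univ] using this
  have hFm : Measurable F := hdiff.continuous.measurable
  have hfF : f = coordM 𝔤 ∘ F ∘ (coordM 𝔤).symm := by
    funext X
    change f X = coordLinear 𝔤 ((coordLinear 𝔤).symm (f (coordLinear 𝔤 ((coordLinear 𝔤).symm X))))
    simp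
  have hfm : Measurable f := by
    rw [hfF]
    exact (coordM 𝔤).measurable.comp (hFm.comp (coordM 𝔤).symm.measurable)
  have hcomp : f ∘ coordM 𝔤 = coordM 𝔤 ∘ F := by
    rw [hfF]
    funext x
    simp
  refine ⟨hfm, ?_⟩
  rw [eq_smul_map_of_map_eq (inv_ne_zero hc) h1, Measure.map_smul,
    Measure.map_map hfm (coordM 𝔤).measurable, hcomp,
    ← Measure.map_map (coordM 𝔤).measurable hFm, hmap]

/-- The properties of the division map `m X Y = X • (-Y)` of a nilpotent group that the calculus
uses: it can be solved for both arguments, and all maps involved preserve the measure. -/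
structure IsDivision (m n s : 𝔤 → 𝔤 → 𝔤) : Prop where
  m_n : ∀ X W, m X (n X W) = W
  n_m : ∀ X Y, n X (m X Y) = Y
  s_n : ∀ X Z, s Z (n X Z) = X
  n_s : ∀ Y Z, n (s Z Y) Z = Y
  measurable_m : Measurable fun z : 𝔤 × 𝔤 => m z.1 z.2
  measurable_n : Measurable fun z : 𝔤 × 𝔤 => n z.1 z.2
  measurable_s : Measurable fun z : 𝔤 × 𝔤 => s z.1 z.2
  measurePreserving_m : ∀ X, MeasurePreserving (m X) μ μ
  measurePreserving_n : ∀ X, MeasurePreserving (n X) μ μ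
  measurePreserving_n_left : ∀ Z, MeasurePreserving (fun X => n X Z) μ μ
  isSchwartz_comp : ∀ X u, IsSchwartz u → IsSchwartz (u ∘ n X)

omit [FiniteDimensional ℝ 𝔤] [LieModule.IsNilpotent 𝔤 𝔤] [TopologicalSpace 𝔤]
  [IsTopologicalAddGroup 𝔤] [ContinuousSMul ℝ 𝔤] [T2Space 𝔤] [MeasurableSpace 𝔤] [BorelSpace 𝔤] in
lemma Lowering.triangular_right {r : 𝔤 → 𝔤 → 𝔤} (hr : Lowering 1 r) (b : ℝ) (X : 𝔤) (j : ℕ)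
    (x v : 𝔤) (hv : v ∈ lowerCentralSeries ℝ 𝔤 𝔤 j) :
    (X + b • (x + v) + r X (x + v)) - (X + b • x + r X x) - b • v ∈
      lowerCentralSeries ℝ 𝔤 𝔤 (j + 1) := by
  have := hr (j := j) (x := X) (x' := X) (y := x + v) (y' := x) (by simp) (by simpa using hv)
  convert this using 1
  rw [smul_add]
  abel

omit [FiniteDimensional ℝ 𝔤] [LieModule.IsNilpotent 𝔤 𝔤] [TopologicalSpace 𝔤]
  [IsTopologicalAddGroup 𝔤] [ContinuousSMul ℝ 𝔤] [T2Space 𝔤] [MeasurableSpace 𝔤] [BorelSpace 𝔤] in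
lemma Lowering.triangular_left {r : 𝔤 → 𝔤 → 𝔤} (hr : Lowering 1 r) (b : ℝ) (Z : 𝔤) (j : ℕ)
    (x v : 𝔤) (hv : v ∈ lowerCentralSeries ℝ 𝔤 𝔤 j) :
    (x + v + b • Z + r (x + v) Z) - (x + b • Z + r x Z) - (1 : ℝ) • v ∈
      lowerCentralSeries ℝ 𝔤 𝔤 (j + 1) := by
  have := hr (j := j) (x := x + v) (x' := x) (y := Z) (y' := Z) (by simpa using hv) (by simp)
  convert this using 1
  rw [one_smul]
  abel

/-- With `m X Y = X - Y + q X Y`, the equation `m X Y = Z` reads `Y = X - Z + q X Y` when solved for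
`Y` and `X = Y + Z - q X Y` when solved for `X`. Both are triangular, which yields `n` and `s`; in
group terms `n X Z = (-Z) • X` and `s Z Y = Z • Y`. -/
lemma exists_isDivision [SecondCountableTopology 𝔤] :
    ∃ n s : 𝔤 → 𝔤 → 𝔤, IsDivision μ (fun X Y => bch X (-Y)) n s := by
  obtain ⟨q₀, hq₀, hq₀', hbch⟩ := exists_bch_eq (𝔤 := 𝔤)
  have hq := hq₀.comp Lowering.fst (Lowering.snd.smul (-1))
  have hq' := hq₀'.comp Temperate₂.fst (Temperate₂.snd.smul (-1))
  set q : 𝔤 → 𝔤 → 𝔤 := fun x y => q₀ x ((-1 : ℝ) • y) with hqdef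
  have hm : ∀ X Y : 𝔤, bch X (-Y) = X + (-1 : ℝ) • Y + q X Y := fun X Y => by
    simp only [hbch, hqdef, neg_one_smul]
  obtain ⟨r, hr, hr', hsol⟩ := exists_solution hq hq' (-1)
  obtain ⟨t, ht, ht', hsol'⟩ := exists_solution (p := fun Y x => (-1 : ℝ) • q x Y)
    (hq.swap.smul (-1)) (hq'.swap.smul (-1)) 1
  set n : 𝔤 → 𝔤 → 𝔤 := fun X W => X + (-1 : ℝ) • W + r X W with hn
  set s : 𝔤 → 𝔤 → 𝔤 := fun Z Y => Y + (1 : ℝ) • Z + t Y Z with hs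
  have hmT : Temperate₂ fun X Y : 𝔤 => bch X (-Y) := by
    simp only [hm]
    exact (Temperate₂.fst.add (Temperate₂.snd.smul (-1))).add hq'
  have hnT : Temperate₂ n := (Temperate₂.fst.add (Temperate₂.snd.smul (-1))).add hr'
  have hsT : Temperate₂ s := (Temperate₂.snd.add (Temperate₂.fst.smul 1)).add ht'.swap
  have hmn : ∀ X Y W, bch X (-Y) = W ↔ Y = n X W := fun X Y W => by
    rw [hm, hn, ← hsol]
    simp only [neg_one_smul]
    constructor
    · rintro rfl; abel
    · intro h; nth_rewrite 1 [h]; abel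
  have hms : ∀ X Y Z, bch X (-Y) = Z ↔ X = s Z Y := fun X Y Z => by
    rw [hm, hs, ← hsol']
    simp only [neg_one_smul, one_smul]
    constructor
    · rintro rfl; abel
    · intro h; nth_rewrite 1 [h]; abel
  have h1 : ∀ X W, bch X (-(n X W)) = W := fun X W => (hmn _ _ _).2 rfl
  have h2 : ∀ X Y, n X (bch X (-Y)) = Y := fun X Y => ((hmn _ _ _).1 rfl).symm
  have h3 : ∀ X Z, s Z (n X Z) = X := fun X Z => ((hms _ _ _).1 (h1 X Z)).symm
  have h4 : ∀ Y Z, n (s Z Y) Z = Y := fun Y Z => ((hmn _ _ _).1 ((hms _ _ _).2 rfl)).symm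
  refine ⟨n, s, h1, h2, h3, h4, hmT.continuous.measurable, hnT.continuous.measurable,
    hsT.continuous.measurable, fun X => ?_, fun X => ?_, fun Z => ?_, fun X u hu => ?_⟩
  · refine measurePreserving_of_triangular μ (hmT.left X) (h2 X) (h1 X) (σ := -1) (by norm_num) ?_
    simp only [hm]
    exact hq.triangular_right (-1) X
  · exact measurePreserving_of_triangular μ (hnT.left X) (h1 X) (h2 X) (σ := -1) (by norm_num)
      (hr.triangular_right (-1) X)
  · exact measurePreserving_of_triangular μ (hnT.swap.left Z) (g := s Z) (fun X => h3 X Z)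
      (fun Y => h4 Y Z) (σ := 1) (by norm_num) (hr.triangular_left (-1) Z)
  · exact hu.comp_temperate (hnT.left X) (hmT.left X) (h1 X)

end Triangular

/-! ### Weighted shifts and their action on kernels -/

section Shift

variable {α : Type*} [MeasurableSpace α] {μ : Measure α}

lemma exists_shift (T : α ≃ᵐ α) (hT : MeasurePreserving T μ μ) {c : α → ℂ} (hc : Measurable c)
    (hc1 : ∀ x, ‖c x‖₊ = 1) :
    ∃ U : Lp ℂ 2 μ ≃ₗᵢ[ℂ] Lp ℂ 2 μ, ∀ f, U f =ᵐ[μ] fun x => c x * f (T x) :=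
  exists_weightedComp T hc one_ne_zero hc1 (by simp [hT.map_eq])

lemma conj_mul_self_of_nnnorm_eq_one {z : ℂ} (hz : ‖z‖₊ = 1) : conj z * z = 1 := by
  have h : ‖z‖ = 1 := congrArg NNReal.toReal hz
  rw [RCLike.conj_mul, h]
  simp

lemma coeFn_shift_symm {T : α ≃ᵐ α} (hT : MeasurePreserving T μ μ) {c : α → ℂ}
    (hc1 : ∀ x, ‖c x‖₊ = 1) {U : Lp ℂ 2 μ ≃ₗᵢ[ℂ] Lp ℂ 2 μ}
    (hU : ∀ f, U f =ᵐ[μ] fun x => c x * f (T x)) (f : Lp ℂ 2 μ) :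
    U.symm f =ᵐ[μ] fun x => conj (c (T.symm x)) * f (T.symm x) := by
  have h := hU (U.symm f)
  rw [LinearIsometryEquiv.apply_symm_apply] at h
  have hT' : MeasurePreserving T.symm μ μ := hT.symm T
  filter_upwards [hT'.quasiMeasurePreserving.ae h] with x hx
  rw [hx, T.apply_symm_apply, ← mul_assoc, conj_mul_self_of_nnnorm_eq_one (hc1 _), one_mul]

variable [SFinite μ]

/-- Conjugating a Hilbert–Schmidt operator by weighted shifts shifts its kernel. -/
lemma exists_shift_kernel {T₁ T₂ : α ≃ᵐ α} (hT₁ : MeasurePreserving T₁ μ μ)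
    (hT₂ : MeasurePreserving T₂ μ μ) {c₁ c₂ : α → ℂ} (hm₁ : Measurable c₁) (hm₂ : Measurable c₂)
    (hc₁ : ∀ x, ‖c₁ x‖₊ = 1) (hc₂ : ∀ x, ‖c₂ x‖₊ = 1) {U₁ U₂ : Lp ℂ 2 μ ≃ₗᵢ[ℂ] Lp ℂ 2 μ}
    (hU₁ : ∀ f, U₁ f =ᵐ[μ] fun x => c₁ x * f (T₁ x))
    (hU₂ : ∀ f, U₂ f =ᵐ[μ] fun x => c₂ x * f (T₂ x)) (K : Lp ℂ 2 (μ.prod μ)) :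
    ∃ K' : Lp ℂ 2 (μ.prod μ),
      (∀ v, kernelOp K' v = U₁ (kernelOp K (U₂.symm v))) ∧
      K' =ᵐ[μ.prod μ] fun z => c₁ z.1 * conj (c₂ z.2) * K (T₁ z.1, T₂ z.2) := by
  obtain ⟨M, hM⟩ := exists_shift (μ := μ.prod μ) (MeasurableEquiv.prodCongr T₁ T₂)
    (hT₁.prod hT₂) (c := fun z => c₁ z.1 * conj (c₂ z.2))
    ((hm₁.comp measurable_fst).mul
      (RCLike.continuous_conj.measurable.comp (hm₂.comp measurable_snd)))
    (fun z => by rw [nnnorm_mul, hc₁, one_mul, RCLike.nnnorm_conj, hc₂])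
  refine ⟨M K, fun v => ext_inner_left ℂ fun p => ?_, hM K⟩
  -- With test vectors `U₁ p` and `U₂ v`, the claim reduces to `M (p ⊗ v̄) = U₁ p ⊗ conj(U₂ v)` and
  -- unitarity of `M`.
  obtain ⟨p, rfl⟩ := U₁.surjective p
  obtain ⟨v, rfl⟩ := U₂.surjective v
  have ht : M (tens p (star v)) = tens (U₁ p) (star (U₂ v)) := by
    ext1
    have hq1 : Measure.QuasiMeasurePreserving (Prod.fst : α × α → α) (μ.prod μ) μ :=
      Measure.quasiMeasurePreserving_fst
    have hq2 : Measure.QuasiMeasurePreserving (Prod.snd : α × α → α) (μ.prod μ) μ :=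
      Measure.quasiMeasurePreserving_snd
    filter_upwards [hM (tens p (star v)), coeFn_tens (U₁ p) (star (U₂ v)),
      (hT₁.prod hT₂).quasiMeasurePreserving.ae (coeFn_tens p (star v)), hq1.ae (hU₁ p),
      hq2.ae (hU₂ v), hq2.ae (Lp.coeFn_star (U₂ v)),
      hq2.ae (hT₂.quasiMeasurePreserving.ae (Lp.coeFn_star v))] with z e1 e2 e3 e4 e5 e6 e7
    rw [e1, e2, e4, e6, Pi.star_apply, e5]
    change _ * tens p (star v) (T₁ z.1, T₂ z.2) = _
    rw [show tens p (star v) (T₁ z.1, T₂ z.2) = _ from e3]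
    simp only [Prod.map_fst, Prod.map_snd]
    rw [e7, Pi.star_apply, star_mul', RCLike.star_def]
    ring
  rw [inner_kernelOp, ← ht, LinearIsometryEquiv.inner_map_map, ← inner_kernelOp,
    LinearIsometryEquiv.inner_map_map, LinearIsometryEquiv.symm_apply_apply]

lemma kernelOp_inj [SecondCountableTopology (Lp ℂ 2 μ)] {K L : Lp ℂ 2 (μ.prod μ)} (h : kernelOp K = kernelOp L) : K = L := by
  rw [← sub_eq_zero]
  exact kernelOp_injective (by rw [kernelOp_sub, h, sub_self])

end Shift

/-! ### Quantization and the symbol calculus -/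

section Quantization

variable {𝔤 : Type*} [LieRing 𝔤] [LieAlgebra ℝ 𝔤] [FiniteDimensional ℝ 𝔤]
  [TopologicalSpace 𝔤] [IsTopologicalAddGroup 𝔤] [ContinuousSMul ℝ 𝔤] [T2Space 𝔤]
  [MeasurableSpace 𝔤] [BorelSpace 𝔤] {μ : Measure 𝔤} [μ.IsAddHaarMeasure]
  {n s : 𝔤 → 𝔤 → 𝔤}

omit [T2Space 𝔤] in
lemma measurable_linear (f : 𝔤 →ₗ[ℝ] ℝ) [T2Space 𝔤] : Measurable f :=
  (LinearMap.continuous_of_finiteDimensional f).measurable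

lemma measurable_pairing : Measurable fun z : 𝔤 × Dual ℝ 𝔤 => z.2 z.1 := by
  have h : (fun z : 𝔤 × Dual ℝ 𝔤 => z.2 z.1) = fun z =>
      ∑ i, (finBasis ℝ 𝔤).coord i z.1 * z.2 (finBasis ℝ 𝔤 i) := by
    funext z
    conv_lhs => rw [← (finBasis ℝ 𝔤).sum_repr z.1]
    simp only [map_sum, map_smul, smul_eq_mul, Basis.coord_apply]
  rw [h]
  refine Finset.measurable_sum _ fun i _ => ?_
  exact ((measurable_linear ((finBasis ℝ 𝔤).coord i)).comp measurable_fst).mul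
    ((measurable_dual_apply (finBasis ℝ 𝔤 i)).comp measurable_snd)

lemma sfinite_dualHaar : SFinite (dualHaar μ) := by
  obtain ⟨c, hc, -, h2⟩ := map_coordM_eq μ
  rw [eq_smul_map_of_map_eq hc h2]
  infer_instance

/-- Division from the left as a measurable equivalence. -/
def IsDivision.equiv {m : 𝔤 → 𝔤 → 𝔤} (hD : IsDivision μ m n s) (X : 𝔤) : 𝔤 ≃ᵐ 𝔤 where
  toFun := m X
  invFun := n X
  left_inv := hD.n_m X
  right_inv := hD.m_n X
  measurable_toFun := (hD.measurePreserving_m X).measurable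
  measurable_invFun := (hD.measurePreserving_n X).measurable

/-- Translation by `Z` as a measurable equivalence. -/
def IsDivision.translation {m : 𝔤 → 𝔤 → 𝔤} (hD : IsDivision μ m n s) (Z : 𝔤) : 𝔤 ≃ᵐ 𝔤 where
  toFun X := n X Z
  invFun := s Z
  left_inv X := hD.s_n X Z
  right_inv Y := hD.n_s Y Z
  measurable_toFun := (hD.measurePreserving_n_left Z).measurable
  measurable_invFun := hD.measurable_s.comp measurable_prodMk_left

omit [TopologicalSpace 𝔤] [IsTopologicalAddGroup 𝔤] [ContinuousSMul ℝ 𝔤] [T2Space 𝔤]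
  [BorelSpace 𝔤] [μ.IsAddHaarMeasure] in
-- The substitution `W = X • (-Y)`, that is `Y = n X W`, makes the phase linear in the integration
-- variable.
lemma opInner_eq (hD : IsDivision μ (fun X Y => bch X (-Y)) n s) (F : Phase 𝔤 → ℂ) (u : 𝔤 → ℂ)
    (X : 𝔤) (ξ : Dual ℝ 𝔤) : opInner μ F u X ξ = F (X, ξ) * hat μ (u ∘ n X) ξ := by
  have h := (hD.measurePreserving_m X).integral_comp (hD.equiv X).measurableEmbedding
    fun W => Complex.exp (Complex.I * (ξ W : ℝ)) * (u ∘ n X) W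
  rw [opInner, hat, ← h, ← integral_const_mul]
  refine integral_congr_ae (Eventually.of_forall fun Y => ?_)
  simp only [Function.comp_apply]
  rw [hD.n_m]
  ring

lemma Quantizes.unique {F : Phase 𝔤 → ℂ} {A B : Lp ℂ 2 μ →L[ℂ] Lp ℂ 2 μ} (hA : Quantizes μ F A)
    (hB : Quantizes μ F B) : A = B := by
  refine IsSchwartz.ext_clm fun u hu => ?_
  ext1
  filter_upwards [hA.2 u _ hu hu.memLp.coeFn_toLp, hB.2 u _ hu hu.memLp.coeFn_toLp] with X h1 h2
  rw [h1.2, h2.2]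

lemma Quantizes.op_eq {F : Phase 𝔤 → ℂ} {A : Lp ℂ 2 μ →L[ℂ] Lp ℂ 2 μ} (hA : Quantizes μ F A) :
    Op μ F = A := by
  have h : ∃ A, Quantizes μ F A := ⟨A, hA⟩
  rw [Op, dif_pos h]
  exact h.choose_spec.unique hA

/-- Weighted composition operators have function symbols. -/
lemma quantizes_shift (hD : IsDivision μ (fun X Y => bch X (-Y)) n s) {T : 𝔤 → 𝔤}
    (hT : MeasurePreserving T μ μ) {c : 𝔤 → ℂ} (hc : Measurable c) {z : 𝔤 → 𝔤} (hz : Measurable z)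
    (hTz : ∀ X, n X (z X) = T X) {U : Lp ℂ 2 μ →L[ℂ] Lp ℂ 2 μ}
    (hU : ∀ f, U f =ᵐ[μ] fun x => c x * f (T x)) :
    Quantizes μ (fun P => c P.1 * Complex.exp (-(Complex.I * (P.2 (z P.1) : ℝ)))) U := by
  refine ⟨?_, fun u U' hu hU' => ?_⟩
  · refine Measurable.aestronglyMeasurable ((hc.comp measurable_fst).mul ?_)
    refine Complex.measurable_exp.comp (Measurable.neg (Measurable.const_mul ?_ _))
    exact Complex.measurable_ofReal.comp
      (measurable_pairing.comp ((hz.comp measurable_fst).prodMk measurable_snd))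
  · filter_upwards [hU U', hT.quasiMeasurePreserving.ae hU'] with X h1 h2
    have hX := hD.isSchwartz_comp X u hu
    have hop : opInner μ (fun P => c P.1 * Complex.exp (-(Complex.I * (P.2 (z P.1) : ℝ)))) u X =
        fun ξ => c X * (Complex.exp (-(Complex.I * (ξ (z X) : ℝ))) * hat μ (u ∘ n X) ξ) := by
      funext ξ
      rw [opInner_eq hD, mul_assoc]
    rw [hop]
    refine ⟨Integrable.const_mul ?_ _, ?_⟩
    · refine hX.integrable_hat.bdd_mul (c := 1) ?_ (Eventually.of_forall fun ξ => ?_)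
      · refine (Complex.measurable_exp.comp
          (Measurable.neg (Measurable.const_mul ?_ _))).aestronglyMeasurable
        exact Complex.measurable_ofReal.comp (measurable_dual_apply _)
      · rw [show -(Complex.I * ((ξ (z X) : ℝ) : ℂ)) = ((-(ξ (z X)) : ℝ) : ℂ) * Complex.I by
          push_cast; ring, Complex.norm_exp_ofReal_mul_I]
    · rw [integral_const_mul, hX.integral_hat, h1, h2, Function.comp_apply, hTz]

lemma IsDivision.measurable_m_s {m : 𝔤 → 𝔤 → 𝔤} (hD : IsDivision μ m n s) (Z : 𝔤)
    (hs : Measurable (s Z)) : Measurable fun X => m X (s Z X) :=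
  hD.measurable_m.comp (measurable_id.prodMk hs)

/-- The inverse of a weighted shift is again a weighted shift, so the adjoint of `Op μ (eps W)` has
a function as symbol and `adj` does not take its default value. -/
lemma quantizes_shift_symm (hD : IsDivision μ (fun X Y => bch X (-Y)) n s) {Z : 𝔤} {c : 𝔤 → ℂ}
    (hc : Measurable c) (hc1 : ∀ x, ‖c x‖₊ = 1) {U : Lp ℂ 2 μ ≃ₗᵢ[ℂ] Lp ℂ 2 μ}
    (hU : ∀ f, U f =ᵐ[μ] fun x => c x * f (n x Z)) :
    Quantizes μ (fun P => conj (c (s Z P.1)) *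
      Complex.exp (-(Complex.I * (P.2 (bch P.1 (-(s Z P.1))) : ℝ))))
      (U.symm : Lp ℂ 2 μ →L[ℂ] Lp ℂ 2 μ) := by
  have hsm : Measurable (s Z) := (hD.translation Z).symm.measurable
  have h1 : MeasurePreserving (s Z) μ μ :=
    (hD.measurePreserving_n_left Z).symm (hD.translation Z)
  have h2 : Measurable fun X => conj (c (s Z X)) :=
    RCLike.continuous_conj.measurable.comp (hc.comp hsm)
  have h3 : Measurable fun X => bch X (-(s Z X)) := hD.measurable_m_s Z hsm
  have h4 : ∀ X, n X (bch X (-(s Z X))) = s Z X := fun X => hD.n_m X (s Z X)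
  have h5 : ∀ f, U.symm f =ᵐ[μ] fun x => conj (c (s Z x)) * f (s Z x) := fun f =>
    coeFn_shift_symm (T := hD.translation Z) (hD.measurePreserving_n_left Z) hc1 hU f
  exact quantizes_shift hD h1 h2 h3 h4 h5

variable [SFinite μ] [SFinite (dualHaar μ)] [SecondCountableTopology (Lp ℂ 2 μ)]

/-- Square-integrable symbols are unitarily equivalent to Hilbert–Schmidt kernels. -/
lemma exists_kernel_equiv (hD : IsDivision μ (fun X Y => bch X (-Y)) n s) :
    ∃ κ : Lp ℂ 2 (phaseMeasure μ) ≃ₗᵢ[ℂ] Lp ℂ 2 (μ.prod μ),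
      ∀ F : Lp ℂ 2 (phaseMeasure μ), Quantizes μ F (kernelOp (κ F)) := by
  obtain ⟨Φ, hΦ⟩ := exists_fourierUnitary μ
  have : SecondCountableTopology (Lp ℂ 2 (dualHaar μ)) :=
    Φ.symm.toHomeomorph.secondCountableTopology
  obtain ⟨W, hW⟩ := exists_partialUnitary (μ := μ) Φ
  let T : 𝔤 × 𝔤 ≃ᵐ 𝔤 × 𝔤 :=
    { toFun := fun z => (z.1, bch z.1 (-z.2))
      invFun := fun z => (z.1, n z.1 z.2)
      left_inv := fun z => Prod.ext rfl (hD.n_m z.1 z.2)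
      right_inv := fun z => Prod.ext rfl (hD.m_n z.1 z.2)
      measurable_toFun := measurable_fst.prodMk hD.measurable_m
      measurable_invFun := measurable_fst.prodMk hD.measurable_n }
  have hT : MeasurePreserving T (μ.prod μ) (μ.prod μ) :=
    (MeasurePreserving.id μ).skew_product (g := fun X Y => bch X (-Y)) hD.measurable_m
      (Eventually.of_forall fun X => (hD.measurePreserving_m X).map_eq)
  obtain ⟨C, hC⟩ := exists_shift T hT (c := fun _ => 1) measurable_const (by simp)
  -- `W'` is the partial Fourier transformation in `ξ`, and `C` inserts `X • (-Y)` for the second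
  -- variable.
  let W' : Lp ℂ 2 (phaseMeasure μ) ≃ₗᵢ[ℂ] Lp ℂ 2 (μ.prod μ) := W.symm
  refine ⟨W'.trans C, fun F => ⟨Lp.aestronglyMeasurable F, fun u U hu hU => ?_⟩⟩
  -- The identity is needed for `v = u ∘ n X`, which varies with `X`; hence one null set for all
  -- `v`.
  have hunif := ae_forall_integral_eq (μ := μ) F (W' F) Φ fun v => by
    rw [← hW]
    exact congrArg (fun G => kernelOp G (Φ v)) (W.apply_symm_apply F).symm
  filter_upwards [hunif, ae_memLp_fiber (μ := μ) (ν := dualHaar μ) F,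
    coeFn_kernelOp ((W'.trans C) F) U, Measure.ae_ae_of_ae_prod (hC (W' F))] with X h1 h2 h3 h4
  have hX := hD.isSchwartz_comp X u hu
  have hv := hΦ _ (hX.integrable (μ := μ)) (hX.memLp (μ := μ))
  have hhat : MemLp (hat μ (u ∘ n X)) 2 (dualHaar μ) := (memLp_congr_ae hv).1 (Lp.memLp _)
  have hop : opInner μ F u X = fun ξ => F (X, ξ) * hat μ (u ∘ n X) ξ :=
    funext fun ξ => opInner_eq hD F u X ξ
  rw [hop]
  refine ⟨integrable_mul_of_memLp_two h2 hhat, ?_⟩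
  have e1 : ∫ ξ, F (X, ξ) * hat μ (u ∘ n X) ξ ∂dualHaar μ =
      ∫ ξ, F (X, ξ) * Φ ((hX.memLp (μ := μ)).toLp _) ξ ∂dualHaar μ := by
    refine integral_congr_ae ?_
    filter_upwards [hv] with ξ h5
    rw [h5]
  have e2 : ∫ y, W' F (X, y) * ((hX.memLp (μ := μ)).toLp (u ∘ n X) : Lp ℂ 2 μ) y ∂μ =
      ∫ y, W' F (X, y) * (u ∘ n X) y ∂μ := by
    refine integral_congr_ae ?_
    filter_upwards [(hX.memLp (μ := μ)).coeFn_toLp] with y h5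
    rw [h5]
  refine h3.trans (Eq.trans ?_ (e1.trans ((h1 _).trans e2)).symm)
  rw [← (hD.measurePreserving_m X).integral_comp
    (hD.equiv X).measurableEmbedding fun W => W' F (X, W) * (u ∘ n X) W]
  refine integral_congr_ae ?_
  filter_upwards [h4, hU] with Y h5 h6
  rw [h6]
  change C (W' F) (X, Y) * u Y = W' F (X, bch X (-Y)) * (u ∘ n X) (bch X (-Y))
  rw [h5, one_mul, Function.comp_apply, hD.n_m]
  rfl

omit [SFinite (dualHaar μ)] in
-- A Hilbert–Schmidt kernel of the composition ensures that a symbol exists; injectivity of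
-- `kernelOp` makes the chosen one irrelevant.
lemma moyal_eq {κ : Lp ℂ 2 (phaseMeasure μ) ≃ₗᵢ[ℂ] Lp ℂ 2 (μ.prod μ)}
    (hκ : ∀ F : Lp ℂ 2 (phaseMeasure μ), Quantizes μ F (kernelOp (κ F))) {F G : Phase 𝔤 → ℂ} {K : Lp ℂ 2 (μ.prod μ)}
    (hK : Op μ F ∘L Op μ G = kernelOp K) : κ (moyal μ F G) = K := by
  have h : ∃ L : Lp ℂ 2 (phaseMeasure μ), Quantizes μ L (Op μ F ∘L Op μ G) :=
    ⟨κ.symm K, by rw [hK]; simpa using hκ (κ.symm K)⟩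
  rw [moyal, dif_pos h]
  refine kernelOp_inj ?_
  rw [← hK]
  exact (hκ h.choose).unique h.choose_spec

lemma nnnorm_cexp_I_mul (r : ℝ) : ‖Complex.exp (Complex.I * (r : ℂ))‖₊ = 1 := by
  ext
  rw [mul_comm, coe_nnnorm, Complex.norm_exp_ofReal_mul_I]
  rfl

/-- The symbol coorbit transform in terms of Hilbert–Schmidt kernels. -/
lemma exists_symbolCoorbit_eq (hD : IsDivision μ (fun X Y => bch X (-Y)) n s) :
    ∃ κ : Lp ℂ 2 (phaseMeasure μ) ≃ₗᵢ[ℂ] Lp ℂ 2 (μ.prod μ),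
      ∀ h f (P : Phase 𝔤 × Phase 𝔤), symbolCoorbit μ h f P =
        ∫ X, conj (κ h X) * (Complex.exp (Complex.I * (P.1.2 X.1 : ℝ)) *
          conj (Complex.exp (Complex.I * (P.2.2 X.2 : ℝ))) *
            κ f (n X.1 P.1.1, n X.2 P.2.1)) ∂μ.prod μ := by
  obtain ⟨κ, hκ⟩ := exists_kernel_equiv hD
  have hcm : ∀ ζ : Dual ℝ 𝔤, Measurable fun X => Complex.exp (Complex.I * (ζ X : ℝ)) := fun ζ =>
    Complex.measurable_exp.comp
      ((Complex.measurable_ofReal.comp (measurable_linear ζ)).const_mul _)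
  have hshift : ∀ W : Phase 𝔤, ∃ U : Lp ℂ 2 μ ≃ₗᵢ[ℂ] Lp ℂ 2 μ,
      ∀ f, U f =ᵐ[μ] fun x => Complex.exp (Complex.I * (W.2 x : ℝ)) * f (n x W.1) := fun W =>
    exists_shift (hD.translation W.1) (hD.measurePreserving_n_left W.1) (hcm W.2)
      (fun x => nnnorm_cexp_I_mul _)
  choose U hU using hshift
  have heps : ∀ W, Op μ (eps W) = (U W : Lp ℂ 2 μ →L[ℂ] Lp ℂ 2 μ) := fun W =>
    (quantizes_shift hD (hD.measurePreserving_n_left W.1) (hcm W.2) (z := fun _ => W.1)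
      measurable_const (fun _ => rfl) (hU W)).op_eq
  have hadj : ∀ W, Op μ (adj μ (eps W)) = ((U W).symm : Lp ℂ 2 μ →L[ℂ] Lp ℂ 2 μ) := fun W => by
    have h1 : ContinuousLinearMap.adjoint (Op μ (eps W)) =
        ((U W).symm : Lp ℂ 2 μ →L[ℂ] Lp ℂ 2 μ) := by
      rw [heps]
      exact LinearIsometryEquiv.adjoint_eq_symm (U W)
    have h2 : ∃ G : Phase 𝔤 → ℂ, Quantizes μ G (ContinuousLinearMap.adjoint (Op μ (eps W))) := by
      rw [h1]
      exact ⟨_, quantizes_shift_symm hD (hcm W.2) (fun x => nnnorm_cexp_I_mul _) (hU W)⟩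
    rw [adj, dif_pos h2, h2.choose_spec.op_eq, h1]
  have hrefl : ∀ f : Lp ℂ 2 μ, LinearIsometryEquiv.refl ℂ (Lp ℂ 2 μ) f =ᵐ[μ]
      fun x => 1 * f (MeasurableEquiv.refl 𝔤 x) := fun f =>
    Eventually.of_forall fun x => (one_mul _).symm
  have h11 : ∀ x : 𝔤, ‖(1 : ℂ)‖₊ = 1 := fun _ => nnnorm_one
  refine ⟨κ, fun h f P => ?_⟩
  -- `K₁` is the kernel of the inner product `ε_Y # f`, with the identity as right shift. It serves
  -- only to show that this product is a genuine symbol; the pointwise formula is taken from `K₂`.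
  obtain ⟨K₁, hK₁, -⟩ := exists_shift_kernel (T₁ := hD.translation P.1.1)
    (T₂ := MeasurableEquiv.refl 𝔤)
    (hD.measurePreserving_n_left P.1.1) (MeasurePreserving.id μ) (hcm P.1.2) measurable_const
    (fun x => nnnorm_cexp_I_mul _) h11 (hU P.1) hrefl (κ f)
  obtain ⟨K₂, hK₂, hK₂'⟩ := exists_shift_kernel (T₁ := hD.translation P.1.1)
    (T₂ := hD.translation P.2.1)
    (hD.measurePreserving_n_left P.1.1) (hD.measurePreserving_n_left P.2.1) (hcm P.1.2) (hcm P.2.2)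
    (fun x => nnnorm_cexp_I_mul _) (fun x => nnnorm_cexp_I_mul _) (hU P.1) (hU P.2) (κ f)
  have m1 : κ (moyal μ (eps P.1) f) = K₁ := by
    refine moyal_eq hκ ?_
    rw [heps, (hκ f).op_eq]
    ext1 v
    rw [hK₁]
    rfl
  have m2 : κ (theta μ P.1 P.2 f) = K₂ := by
    refine moyal_eq hκ ?_
    rw [hadj, (hκ _).op_eq, m1]
    ext1 v
    rw [hK₂, ContinuousLinearMap.comp_apply, hK₁]
    rfl
  rw [symbolCoorbit, ← κ.inner_map_map, m2, inner_eq_integral]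
  refine integral_congr_ae ?_
  filter_upwards [hK₂'] with X hX
  rw [hX]
  rfl

end Quantization

/-! ### Plancherel in one and two variables -/

section Plancherel

lemma ae_ae_lt_top {α β : Type*} [MeasurableSpace α] [MeasurableSpace β] {μ : Measure α}
    {ν : Measure β} [SFinite ν] {Q : α × β → ℝ≥0∞} (hQ : Measurable Q)
    (h : ∫⁻ x, ∫⁻ y, Q (x, y) ∂ν ∂μ ≠ ∞) : ∀ᵐ x ∂μ, ∀ᵐ y ∂ν, Q (x, y) < ∞ := by
  filter_upwards [ae_lt_top hQ.lintegral_prod_right' h] with x hx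
  exact ae_lt_top (hQ.comp measurable_prodMk_left) hx.ne

variable {𝔤 : Type*} [LieRing 𝔤] [LieAlgebra ℝ 𝔤] [FiniteDimensional ℝ 𝔤]
  [TopologicalSpace 𝔤] [IsTopologicalAddGroup 𝔤] [ContinuousSMul ℝ 𝔤] [T2Space 𝔤]
  [MeasurableSpace 𝔤] [BorelSpace 𝔤] {μ : Measure 𝔤} [μ.IsAddHaarMeasure]

lemma measurable_cexp_pairing {α : Type*} [MeasurableSpace α] {ξ : α → Dual ℝ 𝔤} {X : α → 𝔤}
    (hξ : Measurable ξ) (hX : Measurable X) :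
    Measurable fun a => Complex.exp (Complex.I * (ξ a (X a) : ℝ)) :=
  Complex.measurable_exp.comp
    ((Complex.measurable_ofReal.comp (measurable_pairing.comp (hX.prodMk hξ))).const_mul _)

lemma lintegral_enorm_hat_sq {g : 𝔤 → ℂ} (hg : Integrable g μ) (hg2 : MemLp g 2 μ) :
    ∫⁻ ξ, ‖hat μ g ξ‖ₑ ^ 2 ∂(dualHaar μ) = ∫⁻ X, ‖g X‖ₑ ^ 2 ∂μ := by
  obtain ⟨Φ, hΦ⟩ := exists_fourierUnitary μ
  have h1 : ‖Φ (hg2.toLp g)‖ₑ ^ 2 = ‖hg2.toLp g‖ₑ ^ 2 := by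
    rw [LinearIsometryEquiv.enorm_map]
  rw [enorm_sq_eq_lintegral, enorm_sq_eq_lintegral] at h1
  have e1 : ∫⁻ ξ, ‖hat μ g ξ‖ₑ ^ 2 ∂(dualHaar μ) =
      ∫⁻ ξ, ‖Φ (hg2.toLp g) ξ‖ₑ ^ 2 ∂(dualHaar μ) := lintegral_congr_ae <| by
    filter_upwards [hΦ g hg hg2] with ξ h
    rw [h]
  have e2 : ∫⁻ X, ‖hg2.toLp g X‖ₑ ^ 2 ∂μ = ∫⁻ X, ‖g X‖ₑ ^ 2 ∂μ := lintegral_congr_ae <| by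
    filter_upwards [hg2.coeFn_toLp] with X h
    rw [h]
  rw [e1, h1, e2]

lemma lintegral_enorm_conj_hat_sq {g : 𝔤 → ℂ} (hg : Integrable g μ) (hg2 : MemLp g 2 μ) :
    ∫⁻ ξ, ‖∫ X, conj (Complex.exp (Complex.I * (ξ X : ℝ))) * g X ∂μ‖ₑ ^ 2 ∂(dualHaar μ) =
      ∫⁻ X, ‖g X‖ₑ ^ 2 ∂μ := by
  have h1 : Integrable (fun X => conj (g X)) μ :=
    (Complex.conjCLE : ℂ →L[ℝ] ℂ).integrable_comp hg
  have h2 : MemLp (fun X => conj (g X)) 2 μ := hg2.star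
  have h3 := lintegral_enorm_hat_sq h1 h2
  simp only [RCLike.enorm_conj] at h3
  rw [← h3]
  refine lintegral_congr fun ξ => ?_
  rw [hat, ← RCLike.enorm_conj, ← integral_conj]
  simp only [map_mul, RCLike.conj_conj]

variable [SFinite μ] [SFinite (dualHaar μ)]

/-- Plancherel is applied to one variable at a time. The partial transform `H (η, ·)` is integrable
for every `η` by Fubini, and square-integrable for almost every `η` by the first application. -/
lemma lintegral_enorm_hat_prod_sq {G : 𝔤 × 𝔤 → ℂ} (hGm : StronglyMeasurable G)
    (hG : Integrable G (μ.prod μ)) (hG2 : MemLp G 2 (μ.prod μ)) :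
    ∫⁻ η, ∫⁻ ζ, ‖∫ X, Complex.exp (Complex.I * (η X.1 : ℝ)) *
      conj (Complex.exp (Complex.I * (ζ X.2 : ℝ))) * G X ∂μ.prod μ‖ₑ ^ 2
        ∂(dualHaar μ) ∂(dualHaar μ) = ∫⁻ X, ‖G X‖ₑ ^ 2 ∂μ.prod μ := by
  let H : Dual ℝ 𝔤 × 𝔤 → ℂ := fun w =>
    ∫ x, Complex.exp (Complex.I * (w.1 x : ℝ)) * G (x, w.2) ∂μ
  have hH : StronglyMeasurable H := by
    refine StronglyMeasurable.integral_prod_right'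
      (f := fun z : (Dual ℝ 𝔤 × 𝔤) × 𝔤 =>
        Complex.exp (Complex.I * (z.1.1 z.2 : ℝ)) * G (z.2, z.1.2)) ?_
    exact (measurable_cexp_pairing measurable_fst.fst measurable_snd).stronglyMeasurable.mul
      (hGm.comp_measurable (measurable_snd.prodMk measurable_fst.snd))
  have hHe : Measurable fun w => ‖H w‖ₑ ^ 2 := hH.enorm.pow_const 2
  have hGe : Measurable fun X => ‖G X‖ₑ ^ 2 := hGm.enorm.pow_const 2
  have hfin : ∫⁻ X, ‖G X‖ₑ ^ 2 ∂μ.prod μ < ∞ :=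
    (memLp_two_iff_lintegral hGm.aestronglyMeasurable).1 hG2
  have e1 : ∀ᵐ y ∂μ, Integrable (fun x => G (x, y)) μ := hG.swap.prod_right_ae
  have e2 : ∀ᵐ y ∂μ, MemLp (fun x => G (x, y)) 2 μ := by
    have : ∀ᵐ y ∂μ, ∫⁻ x, ‖G (x, y)‖ₑ ^ 2 ∂μ < ∞ := by
      refine ae_lt_top (hGe.lintegral_prod_left') ?_
      rw [← lintegral_prod_symm _ hGe.aemeasurable]
      exact hfin.ne
    filter_upwards [this] with y hy
    refine (memLp_two_iff_lintegral ?_).2 hy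
    exact (hGm.comp_measurable measurable_prodMk_right).aestronglyMeasurable
  have k1 : ∫⁻ η, ∫⁻ y, ‖H (η, y)‖ₑ ^ 2 ∂μ ∂(dualHaar μ) = ∫⁻ X, ‖G X‖ₑ ^ 2 ∂μ.prod μ := by
    rw [lintegral_lintegral_swap hHe.aemeasurable, lintegral_prod_symm _ hGe.aemeasurable]
    refine lintegral_congr_ae ?_
    filter_upwards [e1, e2] with y h1 h2
    exact lintegral_enorm_hat_sq h1 h2
  have hGη : ∀ η : Dual ℝ 𝔤, Integrable
      (fun X : 𝔤 × 𝔤 => Complex.exp (Complex.I * (η X.1 : ℝ)) * G X) (μ.prod μ) := fun η => by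
    refine hG.bdd_mul (c := 1)
      (measurable_cexp_pairing measurable_const measurable_fst).aestronglyMeasurable
      (Eventually.of_forall fun X => ?_)
    rw [mul_comm, Complex.norm_exp_ofReal_mul_I]
  have e3 : ∀ᵐ η ∂(dualHaar μ), ∫⁻ y, ‖H (η, y)‖ₑ ^ 2 ∂μ < ∞ :=
    ae_lt_top hHe.lintegral_prod_right' (by rw [k1]; exact hfin.ne)
  rw [← k1]
  refine lintegral_congr_ae ?_
  filter_upwards [e3] with η hη
  have h1 : Integrable (fun y => H (η, y)) μ := (hGη η).swap.integral_prod_left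
  have h2 : MemLp (fun y => H (η, y)) 2 μ :=
    (memLp_two_iff_lintegral h1.aestronglyMeasurable).2 hη
  rw [← lintegral_enorm_conj_hat_sq h1 h2]
  refine lintegral_congr fun ζ => ?_
  have hi : Integrable (fun X : 𝔤 × 𝔤 => Complex.exp (Complex.I * (η X.1 : ℝ)) *
      conj (Complex.exp (Complex.I * (ζ X.2 : ℝ))) * G X) (μ.prod μ) := by
    have : Integrable (fun X : 𝔤 × 𝔤 => conj (Complex.exp (Complex.I * (ζ X.2 : ℝ))) *
        (Complex.exp (Complex.I * (η X.1 : ℝ)) * G X)) (μ.prod μ) := by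
      refine (hGη η).bdd_mul (c := 1) (RCLike.continuous_conj.measurable.comp
        (measurable_cexp_pairing measurable_const measurable_snd)).aestronglyMeasurable
        (Eventually.of_forall fun X => ?_)
      rw [RCLike.norm_conj, mul_comm, Complex.norm_exp_ofReal_mul_I]
    refine this.congr (Eventually.of_forall fun X => ?_)
    ring
  rw [integral_prod_symm _ hi]
  refine congrArg (fun z : ℂ => ‖z‖ₑ ^ 2) (integral_congr_ae (Eventually.of_forall fun y => ?_))
  simp only [H]
  rw [← integral_const_mul]
  refine integral_congr_ae (Eventually.of_forall fun x => ?_)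
  ring

end Plancherel

/-! ### The coorbit transform of kernels -/

section Coorbit

variable {𝔤 : Type*} [LieRing 𝔤] [LieAlgebra ℝ 𝔤] [FiniteDimensional ℝ 𝔤]
  [TopologicalSpace 𝔤] [IsTopologicalAddGroup 𝔤] [ContinuousSMul ℝ 𝔤] [T2Space 𝔤]
  [MeasurableSpace 𝔤] [BorelSpace 𝔤] {μ : Measure 𝔤} [μ.IsAddHaarMeasure]
  {m n s : 𝔤 → 𝔤 → 𝔤} [SFinite μ]

/-- The coorbit transform of the kernel `l` against the kernel `k`. -/
def kernelCoorbit (μ : Measure 𝔤) (n : 𝔤 → 𝔤 → 𝔤) (k l : Lp ℂ 2 (μ.prod μ))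
    (P : Phase 𝔤 × Phase 𝔤) : ℂ :=
  ∫ X, conj (k X) * (Complex.exp (Complex.I * (P.1.2 X.1 : ℝ)) *
    conj (Complex.exp (Complex.I * (P.2.2 X.2 : ℝ))) *
      l (n X.1 P.1.1, n X.2 P.2.1)) ∂μ.prod μ

omit [μ.IsAddHaarMeasure] in
lemma IsDivision.measurable_shift (hD : IsDivision μ m n s) :
    Measurable fun z : (𝔤 × 𝔤) × 𝔤 × 𝔤 => (n z.2.1 z.1.1, n z.2.2 z.1.2) :=
  (hD.measurable_n.comp (measurable_snd.fst.prodMk measurable_fst.fst)).prodMk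
    (hD.measurable_n.comp (measurable_snd.snd.prodMk measurable_fst.snd))

omit [μ.IsAddHaarMeasure] in
lemma IsDivision.measurePreserving_shift (hD : IsDivision μ m n s) (Y Z : 𝔤) :
    MeasurePreserving (fun X : 𝔤 × 𝔤 => (n X.1 Y, n X.2 Z)) (μ.prod μ) (μ.prod μ) :=
  (hD.measurePreserving_n_left Y).prod (hD.measurePreserving_n_left Z)

omit [μ.IsAddHaarMeasure] in
lemma integrable_kernel_shift (hD : IsDivision μ m n s) (k l : Lp ℂ 2 (μ.prod μ)) (Y Z : 𝔤) :
    Integrable (fun X : 𝔤 × 𝔤 => conj (k X) * l (n X.1 Y, n X.2 Z)) (μ.prod μ) :=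
  integrable_mul_of_memLp_two (Lp.memLp k).star
    ((Lp.memLp l).comp_measurePreserving (hD.measurePreserving_shift Y Z))

omit [μ.IsAddHaarMeasure] in
lemma stronglyMeasurable_kernelCoorbit (hD : IsDivision μ m n s) (k l : Lp ℂ 2 (μ.prod μ)) :
    StronglyMeasurable (kernelCoorbit μ n k l) := by
  refine StronglyMeasurable.integral_prod_right'
    (f := fun z : (Phase 𝔤 × Phase 𝔤) × 𝔤 × 𝔤 => conj (k z.2) *
      (Complex.exp (Complex.I * (z.1.1.2 z.2.1 : ℝ)) *
      conj (Complex.exp (Complex.I * (z.1.2.2 z.2.2 : ℝ))) *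
      l (n z.2.1 z.1.1.1, n z.2.2 z.1.2.1))) ?_
  have h1 := measurable_cexp_pairing (𝔤 := 𝔤)
    (α := (Phase 𝔤 × Phase 𝔤) × 𝔤 × 𝔤) measurable_fst.fst.snd measurable_snd.fst
  have h2 := measurable_cexp_pairing (𝔤 := 𝔤)
    (α := (Phase 𝔤 × Phase 𝔤) × 𝔤 × 𝔤) measurable_fst.snd.snd measurable_snd.snd
  have h3 : Measurable fun z : (Phase 𝔤 × Phase 𝔤) × 𝔤 × 𝔤 =>
      (n z.2.1 z.1.1.1, n z.2.2 z.1.2.1) :=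
    hD.measurable_shift.comp
      ((measurable_fst.fst.fst.prodMk measurable_fst.snd.fst).prodMk measurable_snd)
  exact (RCLike.continuous_conj.comp_stronglyMeasurable
      ((Lp.stronglyMeasurable k).comp_measurable measurable_snd)).mul
    ((h1.mul (RCLike.continuous_conj.measurable.comp h2)).stronglyMeasurable.mul
      ((Lp.stronglyMeasurable l).comp_measurable h3))

omit [μ.IsAddHaarMeasure] in
-- By Tonelli the integral over `(Y, Z)` is done first. For fixed `X` the map `(Y, Z) ↦ (n X₁ Y, n
-- X₂ Z)` preserves the measure, so it contributes `‖l‖²` independently of `X`.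
lemma lintegral_kernel_shift_sq (hD : IsDivision μ m n s) (k l : Lp ℂ 2 (μ.prod μ)) :
    ∫⁻ Y, ∫⁻ Z, ∫⁻ X, ‖conj (k X) * l (n X.1 Y, n X.2 Z)‖ₑ ^ 2 ∂μ.prod μ ∂μ ∂μ =
      ‖k‖ₑ ^ 2 * ‖l‖ₑ ^ 2 := by
  have hk : Measurable fun X => ‖k X‖ₑ ^ 2 := (Lp.stronglyMeasurable k).enorm.pow_const 2
  have hl : Measurable fun X => ‖l X‖ₑ ^ 2 := (Lp.stronglyMeasurable l).enorm.pow_const 2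
  have hm : Measurable fun z : (𝔤 × 𝔤) × 𝔤 × 𝔤 =>
      ‖conj (k z.2) * l (n z.2.1 z.1.1, n z.2.2 z.1.2)‖ₑ ^ 2 := by
    simp only [enorm_mul, RCLike.enorm_conj, mul_pow]
    exact (hk.comp measurable_snd).mul (hl.comp hD.measurable_shift)
  rw [lintegral_lintegral (f := fun Y Z => ∫⁻ X, ‖conj (k X) * l (n X.1 Y, n X.2 Z)‖ₑ ^ 2 ∂μ.prod μ)
      hm.lintegral_prod_right'.aemeasurable,
    lintegral_lintegral_swap (f := fun (p : 𝔤 × 𝔤) (X : 𝔤 × 𝔤) =>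
      ‖conj (k X) * l (n X.1 p.1, n X.2 p.2)‖ₑ ^ 2) hm.aemeasurable,
    enorm_sq_eq_lintegral k, ← lintegral_mul_const _ hk]
  refine lintegral_congr fun X => ?_
  simp only [enorm_mul, RCLike.enorm_conj, mul_pow]
  have hp : MeasurePreserving (fun p : 𝔤 × 𝔤 => (n X.1 p.1, n X.2 p.2)) (μ.prod μ) (μ.prod μ) :=
    (hD.measurePreserving_n X.1).prod (hD.measurePreserving_n X.2)
  have hl' : Measurable fun p : 𝔤 × 𝔤 => ‖l (n X.1 p.1, n X.2 p.2)‖ₑ ^ 2 := hl.comp hp.measurable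
  rw [lintegral_const_mul _ hl', enorm_sq_eq_lintegral l, ← hp.lintegral_comp hl]

variable [SFinite (dualHaar μ)]

/-- For fixed `(Y, Z)` the function to be transformed is integrable by Cauchy–Schwarz. It is
square-integrable only for almost every `(Y, Z)`, by finiteness of the integral in
`lintegral_kernel_shift_sq`, which suffices for Plancherel under the outer integrals. -/
lemma lintegral_kernelCoorbit_sq (hD : IsDivision μ m n s) (k l : Lp ℂ 2 (μ.prod μ)) :
    ∫⁻ P, ‖kernelCoorbit μ n k l P‖ₑ ^ 2 ∂((phaseMeasure μ).prod (phaseMeasure μ)) =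
      ‖k‖ₑ ^ 2 * ‖l‖ₑ ^ 2 := by
  have hC : Measurable fun P => ‖kernelCoorbit μ n k l P‖ₑ ^ 2 :=
    (stronglyMeasurable_kernelCoorbit hD k l).enorm.pow_const 2
  have hm : Measurable fun z : (𝔤 × 𝔤) × 𝔤 × 𝔤 =>
      ‖conj (k z.2) * l (n z.2.1 z.1.1, n z.2.2 z.1.2)‖ₑ ^ 2 := by
    simp only [enorm_mul, RCLike.enorm_conj, mul_pow]
    exact (((Lp.stronglyMeasurable k).enorm.pow_const 2).comp measurable_snd).mul
      (((Lp.stronglyMeasurable l).enorm.pow_const 2).comp hD.measurable_shift)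
  have hm2 : Measurable fun p : 𝔤 × 𝔤 =>
      ∫⁻ X, ‖conj (k X) * l (n X.1 p.1, n X.2 p.2)‖ₑ ^ 2 ∂μ.prod μ := hm.lintegral_prod_right'
  have hfin : ‖k‖ₑ ^ 2 * ‖l‖ₑ ^ 2 < ∞ := by
    refine ENNReal.mul_lt_top ?_ ?_ <;> simp
  have key := lintegral_kernel_shift_sq hD k l
  rw [← key]
  unfold phaseMeasure
  have s1 : Measurable fun p : Phase 𝔤 => ∫⁻ q : Phase 𝔤, ‖kernelCoorbit μ n k l (p, q)‖ₑ ^ 2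
      ∂μ.prod (dualHaar μ) := hC.lintegral_prod_right'
  rw [lintegral_prod _ hC.aemeasurable, lintegral_prod _ s1.aemeasurable]
  have hae : ∀ᵐ Y ∂μ, ∀ᵐ Z ∂μ,
      ∫⁻ X, ‖conj (k X) * l (n X.1 Y, n X.2 Z)‖ₑ ^ 2 ∂μ.prod μ < ∞ :=
    ae_ae_lt_top hm2 (key.trans_lt hfin).ne
  refine lintegral_congr_ae ?_
  filter_upwards [hae] with Y hY
  have s2 : Measurable fun z : (Dual ℝ 𝔤 × 𝔤) × Dual ℝ 𝔤 =>
      ‖kernelCoorbit μ n k l ((Y, z.1.1), (z.1.2, z.2))‖ₑ ^ 2 :=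
    hC.comp ((measurable_const.prodMk measurable_fst.fst).prodMk
      (measurable_fst.snd.prodMk measurable_snd))
  have s3 : ∀ η : Dual ℝ 𝔤, ∫⁻ q : Phase 𝔤, ‖kernelCoorbit μ n k l ((Y, η), q)‖ₑ ^ 2
      ∂μ.prod (dualHaar μ) = ∫⁻ Z, ∫⁻ ζ, ‖kernelCoorbit μ n k l ((Y, η), (Z, ζ))‖ₑ ^ 2
        ∂(dualHaar μ) ∂μ := fun η =>
    lintegral_prod _ (hC.comp measurable_prodMk_left).aemeasurable
  simp only [s3]
  -- The product measure gives the order `Y, η, Z, ζ`; Plancherel needs `η` and `ζ` innermost.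
  rw [lintegral_lintegral_swap (f := fun η Z => ∫⁻ ζ,
    ‖kernelCoorbit μ n k l ((Y, η), (Z, ζ))‖ₑ ^ 2 ∂(dualHaar μ))
    s2.lintegral_prod_right'.aemeasurable]
  refine lintegral_congr_ae ?_
  filter_upwards [hY] with Z hZ
  have g1 : StronglyMeasurable fun X : 𝔤 × 𝔤 => conj (k X) * l (n X.1 Y, n X.2 Z) :=
    (RCLike.continuous_conj.comp_stronglyMeasurable (Lp.stronglyMeasurable k)).mul
      ((Lp.stronglyMeasurable l).comp_measurable (hD.measurePreserving_shift Y Z).measurable)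
  rw [← lintegral_enorm_hat_prod_sq g1 (integrable_kernel_shift hD k l Y Z)
    ((memLp_two_iff_lintegral g1.aestronglyMeasurable).2 hZ)]
  refine lintegral_congr fun η => lintegral_congr fun ζ => ?_
  rw [kernelCoorbit]
  refine congrArg (fun z : ℂ => ‖z‖ₑ ^ 2) (integral_congr_ae (Eventually.of_forall fun X => ?_))
  ring

omit [μ.IsAddHaarMeasure] [SFinite (dualHaar μ)] in
lemma kernelCoorbit_sub (hD : IsDivision μ m n s) (k l l' : Lp ℂ 2 (μ.prod μ)) :
    kernelCoorbit μ n k (l - l') = kernelCoorbit μ n k l - kernelCoorbit μ n k l' := by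
  funext P
  have hi : ∀ l : Lp ℂ 2 (μ.prod μ), Integrable (fun X : 𝔤 × 𝔤 => conj (k X) *
      (Complex.exp (Complex.I * (P.1.2 X.1 : ℝ)) * conj (Complex.exp (Complex.I * (P.2.2 X.2 : ℝ))) *
        l (n X.1 P.1.1, n X.2 P.2.1))) (μ.prod μ) := fun l => by
    have h : Integrable (fun X : 𝔤 × 𝔤 => (Complex.exp (Complex.I * (P.1.2 X.1 : ℝ)) *
        conj (Complex.exp (Complex.I * (P.2.2 X.2 : ℝ)))) *
          (conj (k X) * l (n X.1 P.1.1, n X.2 P.2.1))) (μ.prod μ) := by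
      refine (integrable_kernel_shift hD k l _ _).bdd_mul (c := 1)
        ((measurable_cexp_pairing measurable_const measurable_fst).mul
          (RCLike.continuous_conj.measurable.comp
            (measurable_cexp_pairing measurable_const measurable_snd))).aestronglyMeasurable
        (Eventually.of_forall fun X => ?_)
      rw [norm_mul, RCLike.norm_conj, mul_comm Complex.I, mul_comm Complex.I,
        Complex.norm_exp_ofReal_mul_I, Complex.norm_exp_ofReal_mul_I, one_mul]
    refine h.congr (Eventually.of_forall fun X => ?_)
    ring
  rw [Pi.sub_apply, kernelCoorbit, kernelCoorbit, kernelCoorbit, ← integral_sub (hi l) (hi l')]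
  refine integral_congr_ae ?_
  filter_upwards [(hD.measurePreserving_shift P.1.1 P.2.1).quasiMeasurePreserving.ae
    (Lp.coeFn_sub l l')] with X hX
  rw [hX, Pi.sub_apply]
  ring

end Coorbit

end NilpotentWeyl
end

/-! ### The isometry property of the symbol coorbit transform -/

theorem proposition6p5 {𝔤 : Type*} [LieRing 𝔤] [LieAlgebra ℝ 𝔤] [FiniteDimensional ℝ 𝔤]
    [LieRing.IsNilpotent 𝔤]
    [TopologicalSpace 𝔤] [IsTopologicalAddGroup 𝔤] [ContinuousSMul ℝ 𝔤] [T2Space 𝔤]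
    [MeasurableSpace 𝔤] [BorelSpace 𝔤]
    (μ : Measure 𝔤) [μ.IsAddHaarMeasure]
    (h : Lp ℂ 2 (NilpotentWeyl.phaseMeasure μ)) :
    (∀ f : Lp ℂ 2 (NilpotentWeyl.phaseMeasure μ),
      MemLp (NilpotentWeyl.symbolCoorbit μ h f) 2
        ((NilpotentWeyl.phaseMeasure μ).prod (NilpotentWeyl.phaseMeasure μ)) ∧
      (eLpNorm (NilpotentWeyl.symbolCoorbit μ h f) 2
        ((NilpotentWeyl.phaseMeasure μ).prod (NilpotentWeyl.phaseMeasure μ))).toReal =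
          ‖h‖ * ‖f‖) ∧
    (∀ f g : Lp ℂ 2 (NilpotentWeyl.phaseMeasure μ),
      (eLpNorm (NilpotentWeyl.symbolCoorbit μ h f - NilpotentWeyl.symbolCoorbit μ h g) 2
        ((NilpotentWeyl.phaseMeasure μ).prod (NilpotentWeyl.phaseMeasure μ))).toReal =
          ‖h‖ * ‖f - g‖) := by
  have : SecondCountableTopology 𝔤 := NilpotentWeyl.secondCountableTopology_of_coord 𝔤
  have : LocallyCompactSpace 𝔤 :=
    (NilpotentWeyl.coordL 𝔤).symm.toHomeomorph.isClosedEmbedding.locallyCompactSpace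
  have : SFinite (NilpotentWeyl.dualHaar μ) := NilpotentWeyl.sfinite_dualHaar
  have : LieModule.IsNilpotent 𝔤 𝔤 := inferInstance
  -- A finite exponent makes `L²(μ)` separable, as the dense sequences in the kernel lemmas require.
  have : Fact ((2 : ENNReal) ≠ ⊤) := ⟨by simp⟩
  obtain ⟨n, s, hD⟩ := NilpotentWeyl.exists_isDivision μ
  obtain ⟨κ, hκ⟩ := NilpotentWeyl.exists_symbolCoorbit_eq hD
  have hco : ∀ f, NilpotentWeyl.symbolCoorbit μ h f = NilpotentWeyl.kernelCoorbit μ n (κ h) (κ f) :=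
    fun f => funext fun P => hκ h f P
  have hsq : ∀ k l, eLpNorm (NilpotentWeyl.kernelCoorbit μ n k l) 2
      ((NilpotentWeyl.phaseMeasure μ).prod (NilpotentWeyl.phaseMeasure μ)) = ‖k‖ₑ * ‖l‖ₑ := by
    intro k l
    refine (ENNReal.pow_right_strictMono two_ne_zero).injective ?_
    rw [NilpotentWeyl.eLpNorm_two_sq, NilpotentWeyl.lintegral_kernelCoorbit_sq hD, mul_pow]
  have hnorm : ∀ k l, (eLpNorm (NilpotentWeyl.kernelCoorbit μ n k l) 2
      ((NilpotentWeyl.phaseMeasure μ).prod (NilpotentWeyl.phaseMeasure μ))).toReal =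
        ‖k‖ * ‖l‖ := by
    intro k l
    rw [hsq, ENNReal.toReal_mul, toReal_enorm, toReal_enorm]
  refine ⟨fun f => ?_, fun f g => ?_⟩
  · rw [hco, hnorm, κ.norm_map, κ.norm_map]
    refine ⟨⟨(NilpotentWeyl.stronglyMeasurable_kernelCoorbit hD _ _).aestronglyMeasurable, ?_⟩, rfl⟩
    rw [hsq]
    exact ENNReal.mul_lt_top enorm_lt_top enorm_lt_top
  · rw [hco, hco, ← NilpotentWeyl.kernelCoorbit_sub hD, hnorm, ← map_sub, κ.norm_map, κ.norm_map]
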